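/- **Setting.** Let $(\Omega,\mathcal F,\mathbb P;\mathbb F=(\mathcal F_t)_{t\ge 0})$ be a filtered probability space satisfying the usual conditions, let $\mathcal P$ be the predictable $\sigma$-algebra, and fix $T\ge 0$, $k,\tilde q,v_\infty,\delta_\infty>0$, $\tilde\epsilon\in(0,\tilde q)$, and $\mathcal Q=[-\tilde q,\tilde q]$. Let: - $\Lambda^b,\Lambda^a:\mathbb R\to\mathbb R$ be decreasing $C^2$ functions which, for $\Lambda\in\{\Lambda^b,\Lambda^a\}$, satisfy $\Lambda'<0$, $\lim_{\delta\to+\infty}\Lambda(\delta)=0$ and $\sup_{\delta\in\mathbb R}\Lambda(\delta)\Lambda''(\delta)/\Lambda'(\delta)^2<2$; - $\mu^b,\mu^a$ be probability measures on $\mathbb R_+^*=(0,\infty)$, absolutely continuous with respect to Lebesgue measure, with finite first moments; - $L:\mathbb R\to\mathbb R_+$ be strictly convex, increasing on $\mathbb R_+$, decreasing on $\mathbb R_-$, with $L(0)=0$ and $\lim_{|w|\to\infty}L(w)/|w|=+\infty$; - $\psi,\ell:\mathbb R\to\mathbb R_+$ be continuous; - $\zeta:\mathbb R\to[0,1]$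 be Lipschitz with $\zeta=1$ on $[\tilde\epsilon,\infty)$ and $\zeta=0$ on $(-\infty,0]$. With $v_+=\max(v,0)$, $v_-=\max(-v,0)$, put $$w(v,q)=-v_-\,\zeta(\tilde q+q)+v_+\,\zeta(\tilde q-q),\qquad \tilde{\mathcal L}(v,q)=L(-v_-)\,\zeta(\tilde q+q)+L(v_+)\,\zeta(\tilde q-q).$$ The set $\mathcal A$ of admissible controls consists of all $(\delta,v)$ with $\delta=(\delta^b,\delta^a):\Omega\times[0,T]\times\mathbb R_+^*\to\mathbb R^2$ being $\mathcal P\otimes\mathcal B(\mathbb R_+^*)$-measurable, $\min(\delta^b,\delta^a)\ge-\delta_\infty$ $\mathbb P\otimes dt\otimes dz$-a.e., and $v:\Omega\times[0,T]\to\mathbb R$ being $\mathcal P$-measurable, $|v|\le v_\infty$ $\mathbb P\otimes dt$-a.e. As usual, the filtered probability space is assumed large enough to carry, for every $(t,q)\in[0,T]\times\mathcal Q$ and $(\delta,v)\in\mathcal A$, an inventory process $(q_s)=(q^{t,q,\delta,v}_s)_{s\in[t,T]}$ starting from $q$ at time $t$ (with $q_{t-}=q$). This is a càdlàg adapted process with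 $$dq_s=\int_{\mathbb R_+^*}z\,J^b(ds,dz)-\int_{\mathbb R_+^*}z\,J^a(ds,dz)+w(v_s,q_{s-})\,ds,$$ where $J^b,J^a$ are adapted, nonexplosive $\mathbb R_+^*$-marked point processes (depending on $(t,q,\delta,v)$), almost surely without common jump times, whose intensity kernels on $(t,T]$ are $$\mathbf 1_{\{q_{s-}+z\in\mathcal Q\}}\Lambda^b(\delta^b(s,z))\,\mu^b(dz)\quad\text{and}\quad\mathbf 1_{\{q_{s-}-z\in\mathcal Q\}}\Lambda^a(\delta^a(s,z))\,\mu^a(dz).$$ For every $(t,q)\in[0,T]\times\mathcal Q$ and $(\delta,v)\in\mathcal A$ fix such a process and define $$\begin{aligned}\mathcal J(t,q,\delta,v)=\mathbb E\Big[\int_t^T\Big\{&\int_{\mathbb R_+^*}\big(z\delta^b(s,z)\mathbf 1_{\{q_{s-}+z\in\mathcal Q\}}\Lambda^b(\delta^b(s,z))\mu^b(dz)+z\delta^a(s,z)\mathbf 1_{\{q_{s-}-z\in\mathcal Q\}}\Lambda^a(\delta^a(s,z))\mu^a(dz)\big)\\&+k\,q_{s-}\,w(v_s,q_{s-})-\tilde{\mathcal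 L}(v_s,q_{s-})-\psi(q_{s-})\Big\}ds-\ell(q_{T-})\Big].\end{aligned}$$ The value function is $$\theta(t,q)=\sup_{(\delta,v)\in\mathcal A}\mathcal J(t,q,\delta,v),\qquad(t,q)\in[0,T]\times\mathcal Q,$$ and its lower and upper semicontinuous envelopes on $[0,T]\times\mathcal Q$ are $$\theta_*(t,q)=\liminf_{(s,y)\to(t,q)}\theta(s,y),\qquad\theta^*(t,q)=\limsup_{(s,y)\to(t,q)}\theta(s,y),$$ where $(s,y)$ ranges over $[0,T]\times\mathcal Q$ and $(s,y)=(t,q)$ is allowed. **Proposition.** For every $q\in\mathcal Q$, $$\theta_*(T,q)=\theta^*(T,q)=-\ell(q).$$ In other words, the value function attains its terminal condition continuously. -/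

import Mathlib

open MeasureTheory Filter Topology
open scoped NNReal ENNReal

namespace MarketMaking

/-- The lower semicontinuous envelope `f_*(x) = liminf_{y → x} f(y)` (the value at `x` itself being
taken into account). -/
noncomputable def lowerEnvelope {X : Type*} [TopologicalSpace X] (f : X → EReal) (x : X) : EReal :=
  liminf f (𝓝 x)

/-- The upper semicontinuous envelope `f^*(x) = limsup_{y → x} f(y)`. -/
noncomputable def upperEnvelope {X : Type*} [TopologicalSpace X] (f : X → EReal) (x : X) : EReal :=
  limsup f (𝓝 x)

/-- Lebesgue measure `ds` on the time axis `[0, ∞)`. -/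
noncomputable def timeMeasure : Measure ℝ≥0 :=
  (volume : Measure ℝ).comap ((↑) : ℝ≥0 → ℝ)

/-- The usual conditions: the filtration is right-continuous and `𝓕 0` contains all (measurable or
not) sets of outer measure zero; in particular the space is complete. -/
structure UsualConditions {Ω : Type*} [mΩ : MeasurableSpace Ω] (P : Measure Ω)
    (𝓕 : Filtration ℝ≥0 mΩ) : Prop where
  rightContinuous : 𝓕.IsRightContinuous
  complete : ∀ A : Set Ω, P A = 0 → MeasurableSet[𝓕 0] A

/-- Hypotheses on an intensity function `Λ`. -/
structure IntensityHypotheses (Λ : ℝ → ℝ) : Prop where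
  contDiff : ContDiff ℝ 2 Λ
  strictAnti : StrictAnti Λ
  deriv_neg : ∀ δ, deriv Λ δ < 0
  tendsto_zero : Tendsto Λ atTop (𝓝 0)
  /-- `sup_δ Λ(δ) Λ''(δ) / Λ'(δ)² < 2` -/
  sup_lt_two : ∃ c < 2, ∀ δ, Λ δ * deriv (deriv Λ) δ / (deriv Λ δ) ^ 2 ≤ c

/-- Hypotheses on the execution cost function `L`. -/
structure CostHypotheses (L : ℝ → ℝ) : Prop where
  nonneg : ∀ w, 0 ≤ L w
  zero : L 0 = 0
  strictConvex : StrictConvexOn ℝ Set.univ L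
  mono : MonotoneOn L (Set.Ici 0)
  anti : AntitoneOn L (Set.Iic 0)
  superlinear : Tendsto (fun w => L w / |w|) (cocompact ℝ) atTop

/-- Hypotheses on a distribution of request sizes: a probability measure on `(0, ∞)`, absolutely
continuous with respect to Lebesgue measure, with a finite first moment. -/
structure SizeLawHypotheses (μ : Measure ℝ) : Prop where
  isProbabilityMeasure : IsProbabilityMeasure μ
  support : μ (Set.Iic 0) = 0
  absolutelyContinuous : μ ≪ volume
  integrable_id : Integrable (fun z => z) μ

/-- The parameters of the market making model (with the superscripts `b` for bid and `a` for ask),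
with their standing assumptions. -/
structure Market where
  /-- permanent impact coefficient `k` -/
  k : ℝ
  /-- risk limit: the inventory has to stay in `[-qMax, qMax]` -/
  qMax : ℝ
  /-- width of the zone near the risk limits in which trading is damped -/
  ε : ℝ
  /-- bound on the control of the execution rate -/
  vMax : ℝ
  /-- the quotes are at least `-δMax` -/
  δMax : ℝ
  Λb : ℝ → ℝ
  Λa : ℝ → ℝ
  μb : Measure ℝ
  μa : Measure ℝ
  /-- execution cost function -/
  L : ℝ → ℝ
  /-- running penalty -/
  ψ : ℝ → ℝ
  /-- terminal penalty -/
  ell : ℝ → ℝ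
  /-- Lipschitz approximation of the indicator function of `[0, ∞)` -/
  ζ : ℝ → ℝ
  k_pos : 0 < k
  qMax_pos : 0 < qMax
  ε_pos : 0 < ε
  ε_lt : ε < qMax
  vMax_pos : 0 < vMax
  δMax_pos : 0 < δMax
  hΛb : IntensityHypotheses Λb
  hΛa : IntensityHypotheses Λa
  hμb : SizeLawHypotheses μb
  hμa : SizeLawHypotheses μa
  hL : CostHypotheses L
  ψ_continuous : Continuous ψ
  ψ_nonneg : ∀ q, 0 ≤ ψ q
  ell_continuous : Continuous ell
  ell_nonneg : ∀ q, 0 ≤ ell q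
  ζ_mem : ∀ q, ζ q ∈ Set.Icc (0 : ℝ) 1
  ζ_lipschitz : ∃ K : ℝ≥0, LipschitzWith K ζ
  ζ_one : ∀ q, ε ≤ q → ζ q = 1
  ζ_zero : ∀ q, q ≤ 0 → ζ q = 0

namespace Market

/-- The interval `𝒬` of admissible inventories. -/
def Q (M : Market) : Set ℝ := Set.Icc (-M.qMax) M.qMax

/-- The execution rate `-v₋ ζ(q̃ + q) + v₊ ζ(q̃ - q)`. -/
noncomputable def rate (M : Market) (v q : ℝ) : ℝ :=
  -v⁻ * M.ζ (M.qMax + q) + v⁺ * M.ζ (M.qMax - q)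

/-- The modified execution cost `L(-v₋) ζ(q̃ + q) + L(v₊) ζ(q̃ - q)`. -/
noncomputable def execCost (M : Market) (v q : ℝ) : ℝ :=
  M.L (-v⁻) * M.ζ (M.qMax + q) + M.L v⁺ * M.ζ (M.qMax - q)

/-- The sizes `z > 0` that can be bought from inventory `q`, i.e. `q + z ∈ 𝒬`. -/
def bidSizes (M : Market) (q : ℝ) : Set ℝ := {z | 0 < z ∧ q + z ∈ M.Q}

/-- The sizes `z > 0` that can be sold from inventory `q`, i.e. `q - z ∈ 𝒬`. -/
def askSizes (M : Market) (q : ℝ) : Set ℝ := {z | 0 < z ∧ q - z ∈ M.Q}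

/-- The measure `1_{q + z ∈ 𝒬} Λᵇ(δ(z)) μᵇ(dz)`. -/
noncomputable def bidIntensity (M : Market) (q : ℝ) (δ : ℝ → ℝ) : Measure ℝ :=
  (M.μb.restrict (M.bidSizes q)).withDensity fun z => ENNReal.ofReal (M.Λb (δ z))

/-- The measure `1_{q - z ∈ 𝒬} Λᵃ(δ(z)) μᵃ(dz)`. -/
noncomputable def askIntensity (M : Market) (q : ℝ) (δ : ℝ → ℝ) : Measure ℝ :=
  (M.μa.restrict (M.askSizes q)).withDensity fun z => ENNReal.ofReal (M.Λa (δ z))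

end Market

/-- The σ-algebra `𝒫 ⊗ ℬ(ℝ)` on `(time × Ω) × marks`, with `𝒫` the predictable σ-algebra. -/
abbrev markedPredictable {Ω : Type*} [mΩ : MeasurableSpace Ω] (𝓕 : Filtration ℝ≥0 mΩ) :
    MeasurableSpace ((ℝ≥0 × Ω) × ℝ) :=
  𝓕.predictable.prod (borel ℝ)

/-- Admissible controls: predictable quotes `δᵇ, δᵃ`, bounded below by `-δMax`, and a predictable
execution control `v`, bounded by `vMax`. (Values at times after `T` or at sizes `z ≤ 0` are never
used.) -/
structure Control {Ω : Type*} [mΩ : MeasurableSpace Ω] (P : Measure Ω) (𝓕 : Filtration ℝ≥0 mΩ)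
    (M : Market) (T : ℝ≥0) where
  δb : ℝ≥0 → Ω → ℝ → ℝ
  δa : ℝ≥0 → Ω → ℝ → ℝ
  v : ℝ≥0 → Ω → ℝ
  measurable_δb : Measurable[markedPredictable 𝓕] fun x : (ℝ≥0 × Ω) × ℝ => δb x.1.1 x.1.2 x.2
  measurable_δa : Measurable[markedPredictable 𝓕] fun x : (ℝ≥0 × Ω) × ℝ => δa x.1.1 x.1.2 x.2
  measurable_v : Measurable[𝓕.predictable] fun x : ℝ≥0 × Ω => v x.1 x.2
  δ_ge : ∀ᵐ x ∂(((timeMeasure.restrict (Set.Icc 0 T)).prod P).prod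
      ((volume : Measure ℝ).restrict (Set.Ioi 0))),
    -M.δMax ≤ min (δb x.1.1 x.1.2 x.2) (δa x.1.1 x.1.2 x.2)
  v_le : ∀ᵐ x ∂((timeMeasure.restrict (Set.Icc 0 T)).prod P), |v x.1 x.2| ≤ M.vMax

/-- Adapted, nonexplosive, `(0, ∞)`-marked point processes, seen as integer-valued random measures
`J(dt, dz)` with at most one atom at each time. -/
structure IsMarkedPointProcess {Ω : Type*} [mΩ : MeasurableSpace Ω] (𝓕 : Filtration ℝ≥0 mΩ)
    (J : Ω → Measure (ℝ≥0 × ℝ)) : Prop where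
  adapted : ∀ (s : ℝ≥0) (A : Set ℝ), MeasurableSet A →
    Measurable[𝓕 s] fun ω => J ω (Set.Iic s ×ˢ A)
  integerValued : ∀ ω, ∀ B, MeasurableSet B → ∃ n : ℕ∞, J ω B = n
  finite : ∀ ω, ∀ s : ℝ≥0, J ω (Set.Iic s ×ˢ Set.univ) < ∞
  simple : ∀ ω, ∀ s : ℝ≥0, J ω ({s} ×ˢ Set.univ) ≤ 1
  no_event_at_zero : ∀ ω, J ω ({0} ×ˢ Set.univ) = 0
  marks_pos : ∀ ω, J ω (Set.univ ×ˢ Set.Iic 0) = 0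

/-- On the time interval `(t, T]`, the random measure `J` has the intensity kernel `ν_s(dz)`:
`𝔼 ∫∫ H(s, z) J(ds, dz) = 𝔼 ∫ ∫ H(s, z) ν_s(dz) ds` for every nonnegative
`𝒫 ⊗ ℬ`-measurable `H`. -/
def HasIntensity {Ω : Type*} [mΩ : MeasurableSpace Ω] (P : Measure Ω) (𝓕 : Filtration ℝ≥0 mΩ)
    (t T : ℝ≥0) (J : Ω → Measure (ℝ≥0 × ℝ)) (ν : ℝ≥0 → Ω → Measure ℝ) : Prop :=
  ∀ H : (ℝ≥0 × Ω) × ℝ → ℝ≥0∞, Measurable[markedPredictable 𝓕] H →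
    ∫⁻ ω, ∫⁻ x in Set.Ioc t T ×ˢ Set.univ, H ((x.1, ω), x.2) ∂(J ω) ∂P =
      ∫⁻ ω, ∫⁻ s in Set.Ioc t T, ∫⁻ z, H ((s, ω), z) ∂(ν s ω) ∂timeMeasure ∂P

/-- The left limit `q_{s-}(ω)` of a càdlàg process (with `q_{0-} = q_0`). -/
noncomputable def leftLimit {Ω : Type*} (q : ℝ≥0 → Ω → ℝ) (s : ℝ≥0) (ω : Ω) : ℝ :=
  Function.leftLim (fun r => q r ω) s

/-- An inventory process on `[t, T]` starting from `q₀` at time `t` and controlled by `c`, with the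
marked point processes `Jb`, `Ja` of transactions at the bid and at the ask which drive it. The
process is extended by `q₀` before time `t`, so that `q_{t-} = q₀`. -/
structure ControlledInventory {Ω : Type*} [mΩ : MeasurableSpace Ω] (P : Measure Ω)
    (𝓕 : Filtration ℝ≥0 mΩ) (M : Market) (T t : ℝ≥0) (q₀ : ℝ) (c : Control P 𝓕 M T) where
  q : ℝ≥0 → Ω → ℝ
  Jb : Ω → Measure (ℝ≥0 × ℝ)
  Ja : Ω → Measure (ℝ≥0 × ℝ)
  adapted : ∀ s, Measurable[𝓕 s] (q s)
  rightContinuous : ∀ ω s, ContinuousWithinAt (fun r => q r ω) (Set.Ici s) s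
  leftLimits : ∀ ω s, ∃ l, Tendsto (fun r => q r ω) (𝓝[<] s) (𝓝 l)
  pointProcess_b : IsMarkedPointProcess 𝓕 Jb
  pointProcess_a : IsMarkedPointProcess 𝓕 Ja
  no_common_jumps : ∀ᵐ ω ∂P, ∀ s ∈ Set.Ioc t T,
    Jb ω ({s} ×ˢ Set.univ) = 0 ∨ Ja ω ({s} ×ˢ Set.univ) = 0
  intensity_b : HasIntensity P 𝓕 t T Jb
    fun s ω => M.bidIntensity (leftLimit q s ω) (c.δb s ω)
  intensity_a : HasIntensity P 𝓕 t T Ja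
    fun s ω => M.askIntensity (leftLimit q s ω) (c.δa s ω)
  /-- `dq_s = ∫ z Jᵇ(ds, dz) - ∫ z Jᵃ(ds, dz) + (-(v_s)₋ ζ(q̃ + q_{s-}) + (v_s)₊ ζ(q̃ - q_{s-})) ds`
  on `(t, T]` -/
  dynamics : ∀ᵐ ω ∂P, ∀ s ≤ T,
    q s ω = q₀ + (∫ x in Set.Ioc t s ×ˢ Set.univ, x.2 ∂(Jb ω))
      - (∫ x in Set.Ioc t s ×ˢ Set.univ, x.2 ∂(Ja ω))
      + ∫ r in Set.Ioc t s, M.rate (c.v r ω) (leftLimit q r ω) ∂timeMeasure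

/-- The running reward at the left-limit inventory `y`, for quotes `δb`, `δa` and execution
control `v`. -/
noncomputable def runningReward (M : Market) (δb δa : ℝ → ℝ) (v y : ℝ) : ℝ :=
  (∫ z in M.bidSizes y, z * δb z * M.Λb (δb z) ∂M.μb)
    + (∫ z in M.askSizes y, z * δa z * M.Λa (δa z) ∂M.μa)
    + M.k * y * M.rate v y - M.execCost v y - M.ψ y

/-- The objective `𝒥(t, q₀, δ, v)`: expected running reward over `[t, T]` minus the terminal penalty
`ℓ(q_{T-})`, along the inventory process `I`. -/
noncomputable def objective {Ω : Type*} [mΩ : MeasurableSpace Ω] {P : Measure Ω}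
    {𝓕 : Filtration ℝ≥0 mΩ} {M : Market} {T t : ℝ≥0} {q₀ : ℝ} {c : Control P 𝓕 M T}
    (I : ControlledInventory P 𝓕 M T t q₀ c) : ℝ :=
  ∫ ω, ((∫ s in Set.Ioc t T,
      runningReward M (c.δb s ω) (c.δa s ω) (c.v s ω) (leftLimit I.q s ω)
        ∂timeMeasure)
    - M.ell (leftLimit I.q T ω)) ∂P

/-- A choice, for every initial condition `(t, q) ∈ [0, T] × 𝒬` and every admissible control, of the
inventory process `q^{t,q,δ,v}` on the given filtered probability space. -/
abbrev InventoryFamily {Ω : Type*} [mΩ : MeasurableSpace Ω] (P : Measure Ω)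
    (𝓕 : Filtration ℝ≥0 mΩ) (M : Market) (T : ℝ≥0) :=
  ∀ (t : Set.Icc (0 : ℝ≥0) T) (q : M.Q) (c : Control P 𝓕 M T),
    ControlledInventory P 𝓕 M T (t : ℝ≥0) (q : ℝ) c

/-- The value function `θ(t, q) = sup_{(δ, v) ∈ 𝒜} 𝒥(t, q, δ, v)` on `[0, T] × 𝒬`. The supremum is
taken in the extended reals. -/
noncomputable def valueFunction {Ω : Type*} [mΩ : MeasurableSpace Ω] {P : Measure Ω}
    {𝓕 : Filtration ℝ≥0 mΩ} {M : Market} {T : ℝ≥0} (I : InventoryFamily P 𝓕 M T)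
    (x : Set.Icc (0 : ℝ≥0) T × M.Q) : EReal :=
  ⨆ c : Control P 𝓕 M T, ((objective (I x.1 x.2 c) : ℝ) : EReal)

end MarketMaking

/-! Everything rests on one estimate, uniform in the starting inventory and in the control: the
objective started at time `t` from `y` differs from `-ell y` by a quantity that vanishes as `t`
tends to `T`. The supremum over controls inherits it, continuity of `ell` replaces `y` by nearby
`q`, and the value function therefore converges at `(T, q)`; both envelopes equal the limit.

The estimate (`ControlledInventory.abs_objective_add_le`) has three sources. The running reward is
bounded by a constant, so its time integral is `O(T - t)`; the delicate point is that `δ * Λ δ`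
stays bounded for arbitrarily large quotes, which follows from the condition on `Λ Λ'' / Λ'²`
(`IntensityHypotheses.exists_abs_mul_le`). Quotes bounded below bound the intensities, so the
expected number of jumps is `O(T - t)`. Without a jump the inventory drifts by at most `vMax * (T -
t)`, and `ell` is uniformly continuous on the relevant compact set.

That compact set comes from a crude pathwise bound (`IsInventoryPath.abs_path_le`): every jump lands
in the risk interval, and after the last jump only the drift acts. The fact that jumps land there is
read off from the intensity kernel by testing it on a predictable set (`HasIntensity.ae_ae_mem`),
which requires the left limit to be predictable (`measurable_leftLimit`). -/

namespace MarketMaking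

/-! ### Lebesgue measure on the half-line -/

section TimeMeasure

theorem measurableEmbedding_nnreal_coe : MeasurableEmbedding ((↑) : ℝ≥0 → ℝ) :=
  MeasurableEmbedding.subtype_coe measurableSet_Ici

theorem timeMeasure_apply (A : Set ℝ≥0) :
    timeMeasure A = volume (((↑) : ℝ≥0 → ℝ) '' A) :=
  measurableEmbedding_nnreal_coe.comap_apply _ _

theorem timeMeasure_Ioc (a b : ℝ≥0) :
    timeMeasure (Set.Ioc a b) = ENNReal.ofReal ((b : ℝ) - a) := by
  have h : ((↑) : ℝ≥0 → ℝ) '' Set.Ioc a b = Set.Ioc (a : ℝ) b := by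
    ext x
    constructor
    · rintro ⟨y, hy, rfl⟩
      exact ⟨by exact_mod_cast hy.1, by exact_mod_cast hy.2⟩
    · rintro ⟨h1, h2⟩
      have hx : 0 ≤ x := a.2.trans h1.le
      exact ⟨⟨x, hx⟩, ⟨by exact_mod_cast h1, by exact_mod_cast h2⟩, rfl⟩
  rw [timeMeasure_apply, h, Real.volume_Ioc]

instance : SigmaFinite timeMeasure := by
  refine ⟨⟨⟨fun n : ℕ => Set.Iic (n : ℝ≥0), fun _ => trivial, fun n => ?_, ?_⟩⟩⟩
  · have h : ((↑) : ℝ≥0 → ℝ) '' Set.Iic (n : ℝ≥0) ⊆ Set.Icc 0 n := by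
      rintro _ ⟨y, hy, rfl⟩
      exact ⟨y.2, by exact_mod_cast hy⟩
    rw [timeMeasure_apply]
    exact (measure_mono h).trans_lt (by simp)
  · ext x
    simpa using exists_nat_ge x

theorem timeMeasure_real_Ioc {a b : ℝ≥0} (h : a ≤ b) :
    timeMeasure.real (Set.Ioc a b) = (b : ℝ) - a := by
  rw [Measure.real, timeMeasure_Ioc, ENNReal.toReal_ofReal]
  exact sub_nonneg.2 (by exact_mod_cast h)

theorem Ioc_subset_Icc_zero (t T : ℝ≥0) : Set.Ioc t T ⊆ Set.Icc 0 T :=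
  fun _ hs => ⟨zero_le, hs.2⟩

end TimeMeasure

/-! ### Left limits and their predictability -/

section LeftLimit

variable {Ω : Type*}

theorem tendsto_leftLimit {q : ℝ≥0 → Ω → ℝ} {ω : Ω}
    (hl : ∀ s, ∃ l, Tendsto (fun r => q r ω) (𝓝[<] s) (𝓝 l)) (s : ℝ≥0) :
    Tendsto (fun r => q r ω) (𝓝[<] s) (𝓝 (leftLimit q s ω)) :=
  tendsto_leftLim_of_tendsto (hl s)

theorem leftLimit_zero (q : ℝ≥0 → Ω → ℝ) (ω : Ω) : leftLimit q 0 ω = q 0 ω :=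
  leftLim_eq_of_isBot (fun _ => zero_le)

end LeftLimit

section Predictable

variable {Ω : Type*} [mΩ : MeasurableSpace Ω]

theorem predictable_le_prod (𝓕 : Filtration ℝ≥0 mΩ) :
    𝓕.predictable ≤ (inferInstance : MeasurableSpace (ℝ≥0 × Ω)) := by
  refine measurableSpace_le_predictable_of_measurableSet ?_ ?_
  · intro A hA
    exact (measurableSet_singleton _).prod (𝓕.le _ _ hA)
  · intro i A hA
    exact measurableSet_Ioi.prod (𝓕.le _ _ hA)

theorem markedPredictable_le_prod (𝓕 : Filtration ℝ≥0 mΩ) :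
    markedPredictable 𝓕 ≤ (inferInstance : MeasurableSpace ((ℝ≥0 × Ω) × ℝ)) :=
  sup_le_sup (MeasurableSpace.comap_mono (predictable_le_prod 𝓕)) le_rfl

/-- The largest point of the grid of mesh `1 / (n + 1)` which is strictly smaller than `s > 0`. -/
noncomputable def gridBelow (n : ℕ) (s : ℝ≥0) : ℝ≥0 := ((⌈(n + 1) * s⌉₊ - 1 : ℕ) : ℝ≥0) / (n + 1)

theorem gridBelow_zero (n : ℕ) : gridBelow n 0 = 0 := by simp [gridBelow]

theorem gridBelow_eq_of_mem {n k : ℕ} {s : ℝ≥0}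
    (hs : s ∈ Set.Ioc ((k : ℝ≥0) / (n + 1)) ((k + 1 : ℕ) / (n + 1))) :
    gridBelow n s = k / (n + 1) := by
  have hn : (0 : ℝ≥0) < n + 1 := by positivity
  have hk : ⌈(n + 1) * s⌉₊ = k + 1 := by
    rw [Nat.ceil_eq_iff (Nat.succ_ne_zero k)]
    have h1 := hs.1
    have h2 := hs.2
    rw [div_lt_iff₀' hn] at h1
    rw [le_div_iff₀' hn] at h2
    exact ⟨by simpa using h1, h2⟩
  simp [gridBelow, hk]

theorem exists_mem_Ioc_grid (n : ℕ) {s : ℝ≥0} (hs : 0 < s) :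
    ∃ k : ℕ, s ∈ Set.Ioc ((k : ℝ≥0) / (n + 1)) ((k + 1 : ℕ) / (n + 1)) := by
  have hn : (0 : ℝ≥0) < n + 1 := by positivity
  have hpos : 0 < ⌈(n + 1) * s⌉₊ := Nat.ceil_pos.2 (by positivity)
  obtain ⟨k, hk⟩ := Nat.exists_eq_succ_of_ne_zero hpos.ne'
  refine ⟨k, ?_⟩
  have := (Nat.ceil_eq_iff (Nat.succ_ne_zero k)).1 hk
  rw [Set.mem_Ioc, div_lt_iff₀' hn, le_div_iff₀' hn]
  exact ⟨by simpa using this.1, this.2⟩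

theorem tendsto_gridBelow {s : ℝ≥0} (hs : 0 < s) :
    Tendsto (fun n => gridBelow n s) atTop (𝓝[<] s) := by
  have key : ∀ n : ℕ, gridBelow n s < s ∧ (s : ℝ) - 1 / ((n : ℝ) + 1) ≤ gridBelow n s := by
    intro n
    obtain ⟨k, hk⟩ := exists_mem_Ioc_grid n hs
    rw [gridBelow_eq_of_mem hk]
    refine ⟨hk.1, ?_⟩
    have h2 : (s : ℝ) ≤ ((k + 1 : ℕ) / (n + 1) : ℝ≥0) := by exact_mod_cast hk.2
    push_cast at h2 ⊢
    rw [add_div] at h2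
    linarith
  refine tendsto_nhdsWithin_iff.2 ⟨?_, Eventually.of_forall fun n => (key n).1⟩
  rw [← NNReal.tendsto_coe]
  refine tendsto_of_tendsto_of_tendsto_of_le_of_le (g := fun n : ℕ => (s : ℝ) - 1 / ((n : ℝ) + 1))
    (h := fun _ => (s : ℝ)) ?_ tendsto_const_nhds (fun n => (key n).2)
    (fun n => by exact_mod_cast (key n).1.le)
  simpa using (tendsto_const_nhds (x := (s : ℝ))).sub (tendsto_one_div_add_atTop_nhds_zero_nat (𝕜 := ℝ))

/-- On each left-open cell the process is frozen at the left endpoint, where its value is already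
known, so a preimage is a countable union of predictable rectangles. Time `0` lies in no cell and is
treated apart. -/
theorem measurable_gridBelow_comp {𝓕 : Filtration ℝ≥0 mΩ} {q : ℝ≥0 → Ω → ℝ}
    (hq : ∀ s, Measurable[𝓕 s] (q s)) (n : ℕ) :
    Measurable[𝓕.predictable] fun x : ℝ≥0 × Ω => q (gridBelow n x.1) x.2 := by
  intro B hB
  have : (fun x : ℝ≥0 × Ω => q (gridBelow n x.1) x.2) ⁻¹' B =
      ({⊥} ×ˢ (q 0 ⁻¹' B)) ∪ ⋃ k : ℕ, Set.Ioc ((k : ℝ≥0) / (n + 1)) ((k + 1 : ℕ) / (n + 1)) ×ˢ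
        (q ((k : ℝ≥0) / (n + 1)) ⁻¹' B) := by
    ext ⟨s, ω⟩
    simp only [Set.mem_preimage, Set.mem_union, Set.mem_prod, Set.mem_singleton_iff, Set.mem_iUnion]
    constructor
    · intro h
      rcases eq_or_ne s 0 with rfl | hs
      · left
        exact ⟨rfl, by simpa [gridBelow_zero] using h⟩
      · right
        obtain ⟨k, hk⟩ := exists_mem_Ioc_grid n (pos_iff_ne_zero.2 hs)
        exact ⟨k, hk, by rwa [gridBelow_eq_of_mem hk] at h⟩
    · rintro (⟨hs, h⟩ | ⟨k, hk, h⟩)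
      · have hs : s = 0 := hs
        subst hs
        simpa [gridBelow_zero] using h
      · rwa [gridBelow_eq_of_mem hk]
  rw [this]
  refine MeasurableSet.union (measurableSet_predictable_singleton_bot_prod (hq 0 hB)) ?_
  exact MeasurableSet.iUnion fun k => measurableSet_predictable_Ioc_prod _ _ (hq _ hB)

theorem measurable_leftLimit {𝓕 : Filtration ℝ≥0 mΩ} {q : ℝ≥0 → Ω → ℝ}
    (hq : ∀ s, Measurable[𝓕 s] (q s))
    (hl : ∀ ω s, ∃ l, Tendsto (fun r => q r ω) (𝓝[<] s) (𝓝 l)) :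
    Measurable[𝓕.predictable] fun x : ℝ≥0 × Ω => leftLimit q x.1 x.2 := by
  refine @measurable_of_tendsto_metrizable _ _ 𝓕.predictable _ _ _ _ _ _
    (fun n => measurable_gridBelow_comp hq n) ?_
  rw [tendsto_pi_nhds]
  rintro ⟨s, ω⟩
  rcases eq_or_ne s 0 with rfl | hs
  · simp [gridBelow_zero, leftLimit_zero]
  · exact (tendsto_leftLimit (hl ω) s).comp (tendsto_gridBelow (pos_iff_ne_zero.2 hs))

end Predictable

/-! ### Measurability of integrals against a point process -/

section NormalizedMeasure

variable {Ω : Type*}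

/-- The random measure `J`, restricted to `(t, T]` and divided by one plus its mass. -/
noncomputable def normalizedMeasure (J : Ω → Measure (ℝ≥0 × ℝ)) (t T : ℝ≥0) (ω : Ω) :
    Measure (ℝ≥0 × ℝ) :=
  (1 + J ω (Set.Ioc t T ×ˢ Set.univ))⁻¹ • (J ω).restrict (Set.Ioc t T ×ˢ Set.univ)

theorem normalizedMeasure_univ_le (J : Ω → Measure (ℝ≥0 × ℝ)) (t T : ℝ≥0) (ω : Ω) :
    normalizedMeasure J t T ω Set.univ ≤ 1 := by
  simp only [normalizedMeasure, Measure.smul_apply, smul_eq_mul, Measure.restrict_apply_univ]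
  rw [mul_comm, ← div_eq_mul_inv]
  exact ENNReal.div_le_of_le_mul (by rw [one_mul]; exact le_add_self)

end NormalizedMeasure

section PointProcess

variable {Ω : Type*} [mΩ : MeasurableSpace Ω] {𝓕 : Filtration ℝ≥0 mΩ} {J : Ω → Measure (ℝ≥0 × ℝ)}

theorem IsMarkedPointProcess.measure_Ioc_lt_top (hJ : IsMarkedPointProcess 𝓕 J) (ω : Ω)
    (t T : ℝ≥0) : J ω (Set.Ioc t T ×ˢ Set.univ) < ∞ :=
  (measure_mono (Set.prod_mono_left Set.Ioc_subset_Iic_self)).trans_lt (hJ.finite ω T)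

theorem IsMarkedPointProcess.measurable_measure_Ioc_prod (hJ : IsMarkedPointProcess 𝓕 J)
    (a b : ℝ≥0) {A : Set ℝ} (hA : MeasurableSet A) : Measurable fun ω => J ω (Set.Ioc a b ×ˢ A) := by
  rcases le_total b a with hab | hab
  · simp [Set.Ioc_eq_empty (not_lt.2 hab)]
  have h : ∀ ω, J ω (Set.Ioc a b ×ˢ A) = J ω (Set.Iic b ×ˢ A) - J ω (Set.Iic a ×ˢ A) := by
    intro ω
    rw [← measure_sdiff (Set.prod_mono_left (Set.Iic_subset_Iic.2 hab))
      (measurableSet_Iic.prod hA).nullMeasurableSet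
      ((measure_mono (Set.prod_mono_right (Set.subset_univ _))).trans_lt (hJ.finite ω a)).ne]
    congr 1
    ext x
    simp only [Set.mem_prod, Set.mem_Ioc, Set.mem_sdiff, Set.mem_Iic, ← not_le]
    tauto
  simp_rw [h]
  exact ((hJ.adapted b A hA).mono (𝓕.le b) le_rfl).sub ((hJ.adapted a A hA).mono (𝓕.le a) le_rfl)

/-- Adaptedness controls the mass of rectangles `Iic s ×ˢ A`; these form a π-system generating the
product σ-algebra. -/
theorem IsMarkedPointProcess.measurable_normalizedMeasure (hJ : IsMarkedPointProcess 𝓕 J)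
    (t T : ℝ≥0) : Measurable (normalizedMeasure J t T) := by
  have hgen : (inferInstance : MeasurableSpace (ℝ≥0 × ℝ)) = MeasurableSpace.generateFrom
      (Set.image2 (· ×ˢ ·) (Set.range Set.Iic) {A : Set ℝ | MeasurableSet A}) := by
    refine (generateFrom_eq_prod ?_ MeasurableSpace.generateFrom_measurableSet ?_ ?_).symm
    · rw [← borel_eq_generateFrom_Iic]
      exact (BorelSpace.measurable_eq (α := ℝ≥0)).symm
    · exact ⟨fun n => Set.Iic n, fun n => ⟨n, rfl⟩, by
        ext x
        simpa using exists_nat_ge x⟩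
    · exact isCountablySpanning_measurableSet
  have hfin : ∀ ω, IsFiniteMeasure (normalizedMeasure J t T ω) := fun ω =>
    ⟨(normalizedMeasure_univ_le J t T ω).trans_lt ENNReal.one_lt_top⟩
  have hN : Measurable fun ω => (1 + J ω (Set.Ioc t T ×ˢ Set.univ))⁻¹ :=
    (measurable_const.add (hJ.measurable_measure_Ioc_prod t T MeasurableSet.univ)).inv
  refine Measurable.measure_of_isPiSystem hgen (isPiSystem_Iic.prod MeasurableSpace.isPiSystem_measurableSet)
    ?_ ?_
  · rintro _ ⟨_, ⟨s, rfl⟩, A, hA, rfl⟩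
    have hA : MeasurableSet A := hA
    have : ∀ ω, normalizedMeasure J t T ω (Set.Iic s ×ˢ A) =
        (1 + J ω (Set.Ioc t T ×ˢ Set.univ))⁻¹ * J ω (Set.Ioc t (min s T) ×ˢ A) := by
      intro ω
      simp only [normalizedMeasure, Measure.smul_apply, smul_eq_mul]
      rw [Measure.restrict_apply (measurableSet_Iic.prod hA)]
      congr 2
      ext x
      simp
      tauto
    simp_rw [this]
    exact hN.mul (hJ.measurable_measure_Ioc_prod t _ hA)
  · simp only [normalizedMeasure, Measure.smul_apply, smul_eq_mul, Measure.restrict_apply_univ]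
    exact hN.mul (hJ.measurable_measure_Ioc_prod t T MeasurableSet.univ)

/-- The masses `J ω` are finite but not bounded uniformly in `ω`. The normalized measures form a
finite kernel, to which the parametrized-integral theorem applies; multiplying by one plus the mass
undoes the normalization. -/
theorem IsMarkedPointProcess.measurable_lintegral (hJ : IsMarkedPointProcess 𝓕 J) (t T : ℝ≥0)
    {H : (ℝ≥0 × Ω) × ℝ → ℝ≥0∞} (hH : Measurable[markedPredictable 𝓕] H) :
    Measurable fun ω => ∫⁻ x in Set.Ioc t T ×ˢ Set.univ, H ((x.1, ω), x.2) ∂(J ω) := by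
  let K : ProbabilityTheory.Kernel Ω (ℝ≥0 × ℝ) :=
    ⟨normalizedMeasure J t T, hJ.measurable_normalizedMeasure t T⟩
  have : ProbabilityTheory.IsFiniteKernel K :=
    ⟨1, ENNReal.one_lt_top, normalizedMeasure_univ_le J t T⟩
  have hH' : Measurable H := hH.mono (markedPredictable_le_prod 𝓕) le_rfl
  have hm : Measurable fun p : Ω × (ℝ≥0 × ℝ) => H ((p.2.1, p.1), p.2.2) :=
    hH'.comp (by fun_prop)
  have h := hm.lintegral_kernel_prod_right' (κ := K)
  have hN : Measurable fun ω => 1 + J ω (Set.Ioc t T ×ˢ Set.univ) :=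
    measurable_const.add (hJ.measurable_measure_Ioc_prod t T MeasurableSet.univ)
  convert hN.mul h using 2 with ω
  simp only [K, ProbabilityTheory.Kernel.coe_mk, normalizedMeasure, lintegral_smul_measure, smul_eq_mul, Pi.mul_apply]
  rw [← mul_assoc, ENNReal.mul_inv_cancel, one_mul]
  · simp
  · exact (ENNReal.add_lt_top.2 ⟨ENNReal.one_lt_top, hJ.measure_Ioc_lt_top ω t T⟩).ne

end PointProcess

/-! ### Deterministic analysis of a single inventory path -/

section Paths

/-- The last jump is the infimum of the times `r` after which `J` has no mass up to `s`. Integrality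
makes the mass at least one on every `(u, s]` with `t < u < r`, and continuity from above then
forces an atom at the infimum, unless it is `t`. -/
theorem exists_last_jump {J : Measure (ℝ≥0 × ℝ)} {t s : ℝ≥0}
    (hint : ∀ B, MeasurableSet B → ∃ n : ℕ∞, J B = n) (hfin : J (Set.Ioc t s ×ˢ Set.univ) < ∞)
    (hts : t ≤ s) :
    ∃ r ∈ Set.Icc t s, J (Set.Ioc r s ×ˢ Set.univ) = 0 ∧ (r = t ∨ J ({r} ×ˢ Set.univ) ≠ 0) := by
  set S : Set ℝ≥0 := {r | r ∈ Set.Icc t s ∧ J (Set.Ioc r s ×ˢ Set.univ) = 0} with hS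
  have hsS : s ∈ S := ⟨⟨hts, le_rfl⟩, by simp⟩
  have hbdd : BddBelow S := OrderBot.bddBelow S
  set r := sInf S with hr
  have htr : t ≤ r := le_csInf ⟨s, hsS⟩ fun _ hx => hx.1.1
  have hrs : r ≤ s := csInf_le hbdd hsS
  -- The infimum is attained: `(r, s]` is covered by countably many null intervals.
  have hzero : J (Set.Ioc r s ×ˢ Set.univ) = 0 := by
    obtain ⟨u, -, hu, huS⟩ := exists_seq_tendsto_sInf ⟨s, hsS⟩ hbdd
    have hsub : Set.Ioc r s ×ˢ (Set.univ : Set ℝ) ⊆ ⋃ n, Set.Ioc (u n) s ×ˢ Set.univ := by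
      rintro ⟨x, z⟩ ⟨hx, -⟩
      obtain ⟨n, hn⟩ := (hu.eventually_lt_const hx.1).exists
      exact Set.mem_iUnion.2 ⟨n, ⟨hn, hx.2⟩, trivial⟩
    exact measure_mono_null hsub (measure_iUnion_null fun n => (huS n).2)
  refine ⟨r, ⟨htr, hrs⟩, hzero, or_iff_not_imp_left.2 fun hne hJr => ?_⟩
  have htr' : t < r := lt_of_le_of_ne htr (Ne.symm hne)
  obtain ⟨u, hmono, hu, hlim⟩ := exists_seq_strictMono_tendsto' htr'
  have hone : ∀ n, 1 ≤ J (Set.Ioc (u n) s ×ˢ Set.univ) := by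
    intro n
    obtain ⟨k, hk⟩ := hint (Set.Ioc (u n) s ×ˢ Set.univ) (measurableSet_Ioc.prod .univ)
    have hk0 : k ≠ 0 := by
      rintro rfl
      exact (hu n).2.not_ge (csInf_le hbdd ⟨⟨(hu n).1.le, (hu n).2.le.trans hrs⟩, by simpa using hk⟩)
    rw [hk]
    exact_mod_cast Order.one_le_iff_ne_zero.2 hk0
  have hcont := tendsto_measure_iInter_atTop (μ := J)
    (s := fun n => Set.Ioc (u n) s ×ˢ (Set.univ : Set ℝ))
    (fun n => (measurableSet_Ioc.prod .univ).nullMeasurableSet)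
    (fun m n hmn => Set.prod_mono_left (Set.Ioc_subset_Ioc_left (hmono.monotone hmn)))
    ⟨0, ((measure_mono (Set.prod_mono_left (Set.Ioc_subset_Ioc_left (hu 0).1.le))).trans_lt
      hfin).ne⟩
  have h1 : 1 ≤ J (⋂ n, Set.Ioc (u n) s ×ˢ (Set.univ : Set ℝ)) :=
    ge_of_tendsto hcont (Eventually.of_forall hone)
  have hsub : (⋂ n, Set.Ioc (u n) s ×ˢ (Set.univ : Set ℝ)) ⊆
      {r} ×ˢ Set.univ ∪ Set.Ioc r s ×ˢ Set.univ := by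
    rintro ⟨x, z⟩ hx
    simp only [Set.mem_iInter, Set.mem_prod, Set.mem_Ioc, Set.mem_univ, and_true] at hx
    have hrx : r ≤ x := le_of_tendsto hlim (Eventually.of_forall fun n => (hx n).1.le)
    rcases hrx.eq_or_lt with rfl | h
    · left; exact ⟨rfl, trivial⟩
    · right; exact ⟨⟨h, (hx 0).2⟩, trivial⟩
  have h0 : J ({r} ×ˢ Set.univ ∪ Set.Ioc r s ×ˢ Set.univ) = 0 := measure_union_null hJr hzero
  rw [measure_mono_null hsub h0] at h1
  exact absurd h1 (by simp)

/-- At a jump time the measure has mass exactly one, so the jump size is the mean of the mark under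
a probability measure, and averages stay in a closed convex set. The sign `σ` serves bid and ask at
once. -/
theorem add_integral_jump_mem {J : Measure (ℝ≥0 × ℝ)} {t T r : ℝ≥0} {σ Q : ℝ} {ql : ℝ≥0 → ℝ}
    (hint : ∀ B, MeasurableSet B → ∃ n : ℕ∞, J B = n) (hsimple : J ({r} ×ˢ Set.univ) ≤ 1)
    (hr : r ∈ Set.Ioc t T) (hne : J ({r} ×ˢ Set.univ) ≠ 0)
    (hinteg : IntegrableOn (fun x => x.2) (Set.Ioc t T ×ˢ Set.univ) J)
    (hjump : ∀ᵐ x ∂J.restrict (Set.Ioc t T ×ˢ Set.univ), ql x.1 + σ * x.2 ∈ Set.Icc (-Q) Q) :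
    ql r + σ * ∫ x in {r} ×ˢ Set.univ, x.2 ∂J ∈ Set.Icc (-Q) Q := by
  have hmeas : MeasurableSet ({r} ×ˢ (Set.univ : Set ℝ)) := (measurableSet_singleton r).prod .univ
  have hone : J ({r} ×ˢ Set.univ) = 1 := by
    refine le_antisymm hsimple ?_
    obtain ⟨k, hk⟩ := hint _ hmeas
    rw [hk] at hne ⊢
    exact_mod_cast Order.one_le_iff_ne_zero.2 (by exact_mod_cast hne)
  have hprob : IsProbabilityMeasure (J.restrict ({r} ×ˢ Set.univ)) := ⟨by simpa using hone⟩
  have hsub : {r} ×ˢ (Set.univ : Set ℝ) ⊆ Set.Ioc t T ×ˢ Set.univ :=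
    Set.prod_mono_left (Set.singleton_subset_iff.2 hr)
  have hi : Integrable (fun x : ℝ≥0 × ℝ => x.2) (J.restrict ({r} ×ˢ Set.univ)) :=
    hinteg.mono_set hsub
  have hae : ∀ᵐ x ∂J.restrict ({r} ×ˢ Set.univ), ql r + σ * x.2 ∈ Set.Icc (-Q) Q := by
    filter_upwards [ae_restrict_of_ae_restrict_of_subset hsub hjump, ae_restrict_mem hmeas]
      with x hx hxr
    have : x.1 = r := hxr.1
    rwa [this] at hx
  have h := (convex_Icc (-Q) Q).integral_mem isClosed_Icc hae
    ((integrable_const _).add (hi.const_mul σ))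
  rwa [integral_add (integrable_const _) (hi.const_mul σ), integral_const, integral_const_mul,
    probReal_univ, one_smul] at h

theorem tendsto_setIntegral_Ioc_prod {J : Measure (ℝ≥0 × ℝ)} {t T r : ℝ≥0} {u : ℕ → ℝ≥0}
    (hr : r ∈ Set.Ioc t T) (hmono : StrictMono u) (hu : ∀ n, u n ∈ Set.Ioo t r)
    (hlim : Tendsto u atTop (𝓝 r))
    (hinteg : IntegrableOn (fun x => x.2) (Set.Ioc t T ×ˢ Set.univ) J) :
    Tendsto (fun n => ∫ x in Set.Ioc (u n) r ×ˢ Set.univ, x.2 ∂J) atTop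
      (𝓝 (∫ x in {r} ×ˢ Set.univ, x.2 ∂J)) := by
  have hInter : (⋂ n, Set.Ioc (u n) r ×ˢ (Set.univ : Set ℝ)) = {r} ×ˢ Set.univ := by
    ext ⟨x, z⟩
    simp only [Set.mem_iInter, Set.mem_prod, Set.mem_Ioc, Set.mem_univ, and_true,
      Set.mem_singleton_iff]
    constructor
    · intro h
      exact le_antisymm (h 0).2 (le_of_tendsto hlim (Eventually.of_forall fun n => (h n).1.le))
    · rintro rfl n
      exact ⟨(hu n).2, le_rfl⟩
  rw [← hInter]
  refine tendsto_setIntegral_of_antitone (fun n => measurableSet_Ioc.prod .univ)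
    (fun m n hmn => Set.prod_mono_left (Set.Ioc_subset_Ioc_left (hmono.monotone hmn))) ⟨0, ?_⟩
  exact hinteg.mono_set (Set.prod_mono_left (Set.Ioc_subset_Ioc (hu 0).1.le hr.2))

/-- Paths `q` on `[t, T]` driven by two integer-valued measures `Jb`, `Ja` without common jumps and
by a rate `ρ` bounded by `V`, all of whose jumps lead into `[-Q, Q]`; `ql` is the left limit. -/
structure IsInventoryPath (Q V q₀ : ℝ) (t T : ℝ≥0) (q ql ρ : ℝ≥0 → ℝ)
    (Jb Ja : Measure (ℝ≥0 × ℝ)) : Prop where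
  start_mem : q₀ ∈ Set.Icc (-Q) Q
  bound_nonneg : 0 ≤ V
  integer_b : ∀ B, MeasurableSet B → ∃ n : ℕ∞, Jb B = n
  integer_a : ∀ B, MeasurableSet B → ∃ n : ℕ∞, Ja B = n
  finite_b : Jb (Set.Ioc t T ×ˢ Set.univ) < ∞
  finite_a : Ja (Set.Ioc t T ×ˢ Set.univ) < ∞
  simple_b : ∀ s : ℝ≥0, Jb ({s} ×ˢ Set.univ) ≤ 1
  simple_a : ∀ s : ℝ≥0, Ja ({s} ×ˢ Set.univ) ≤ 1
  integrable_b : IntegrableOn (fun x => x.2) (Set.Ioc t T ×ˢ Set.univ) Jb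
  integrable_a : IntegrableOn (fun x => x.2) (Set.Ioc t T ×ˢ Set.univ) Ja
  no_common : ∀ s ∈ Set.Ioc t T, Jb ({s} ×ˢ Set.univ) = 0 ∨ Ja ({s} ×ˢ Set.univ) = 0
  dynamics : ∀ s ≤ T, q s = q₀ + (∫ x in Set.Ioc t s ×ˢ Set.univ, x.2 ∂Jb)
      - (∫ x in Set.Ioc t s ×ˢ Set.univ, x.2 ∂Ja) + ∫ r in Set.Ioc t s, ρ r ∂timeMeasure
  integrable_rate : IntegrableOn ρ (Set.Ioc t T) timeMeasure
  rate_le : ∀ᵐ s ∂timeMeasure.restrict (Set.Ioc t T), |ρ s| ≤ V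
  leftLim : ∀ s, Tendsto q (𝓝[<] s) (𝓝 (ql s))
  jump_b : ∀ᵐ x ∂Jb.restrict (Set.Ioc t T ×ˢ Set.univ), ql x.1 + x.2 ∈ Set.Icc (-Q) Q
  jump_a : ∀ᵐ x ∂Ja.restrict (Set.Ioc t T ×ˢ Set.univ), ql x.1 - x.2 ∈ Set.Icc (-Q) Q

namespace IsInventoryPath

variable {Q V q₀ : ℝ} {t T : ℝ≥0} {q ql ρ : ℝ≥0 → ℝ} {Jb Ja : Measure (ℝ≥0 × ℝ)}

theorem setIntegral_Ioc_prod_add {J : Measure (ℝ≥0 × ℝ)}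
    (hJ : IntegrableOn (fun x => x.2) (Set.Ioc t T ×ˢ Set.univ) J) {r s : ℝ≥0} (htr : t ≤ r)
    (hrs : r ≤ s) (hs : s ≤ T) :
    ∫ x in Set.Ioc t s ×ˢ Set.univ, x.2 ∂J =
      (∫ x in Set.Ioc t r ×ˢ Set.univ, x.2 ∂J) + ∫ x in Set.Ioc r s ×ˢ Set.univ, x.2 ∂J := by
  rw [← Set.Ioc_union_Ioc_eq_Ioc htr hrs, Set.union_prod]
  refine setIntegral_union ?_ (measurableSet_Ioc.prod .univ) (hJ.mono_set ?_) (hJ.mono_set ?_)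
  · exact Set.Disjoint.set_prod_left (Set.Ioc_disjoint_Ioc_of_le le_rfl) _ _
  · exact Set.prod_mono_left (Set.Ioc_subset_Ioc_right (hrs.trans hs))
  · exact Set.prod_mono_left (Set.Ioc_subset_Ioc htr hs)

theorem increment (h : IsInventoryPath Q V q₀ t T q ql ρ Jb Ja) {r s : ℝ≥0} (htr : t ≤ r)
    (hrs : r ≤ s) (hs : s ≤ T) :
    q s = q r + (∫ x in Set.Ioc r s ×ˢ Set.univ, x.2 ∂Jb)
      - (∫ x in Set.Ioc r s ×ˢ Set.univ, x.2 ∂Ja) + ∫ x in Set.Ioc r s, ρ x ∂timeMeasure := by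
  rw [h.dynamics s hs, h.dynamics r (hrs.trans hs), setIntegral_Ioc_prod_add h.integrable_b htr hrs hs,
    setIntegral_Ioc_prod_add h.integrable_a htr hrs hs, ← Set.Ioc_union_Ioc_eq_Ioc htr hrs,
    setIntegral_union (Set.Ioc_disjoint_Ioc_of_le le_rfl) measurableSet_Ioc
      (h.integrable_rate.mono_set (Set.Ioc_subset_Ioc_right (hrs.trans hs)))
      (h.integrable_rate.mono_set (Set.Ioc_subset_Ioc htr hs))]
  ring

theorem abs_integral_rate_le (h : IsInventoryPath Q V q₀ t T q ql ρ Jb Ja) {r s : ℝ≥0}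
    (htr : t ≤ r) (hrs : r ≤ s) (hs : s ≤ T) :
    |∫ x in Set.Ioc r s, ρ x ∂timeMeasure| ≤ V * ((s : ℝ) - r) := by
  have h1 := norm_setIntegral_le_of_norm_le_const_ae' (μ := timeMeasure) (f := ρ) (C := V)
    (s := Set.Ioc r s) (by rw [timeMeasure_Ioc]; exact ENNReal.ofReal_lt_top)
    ((ae_restrict_iff' measurableSet_Ioc).1
      (ae_restrict_of_ae_restrict_of_subset (Set.Ioc_subset_Ioc htr hs) h.rate_le))
  rwa [timeMeasure_real_Ioc hrs] at h1

theorem before_start (h : IsInventoryPath Q V q₀ t T q ql ρ Jb Ja) (htT : t ≤ T) {s : ℝ≥0}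
    (hs : s ≤ t) : q s = q₀ := by
  rw [h.dynamics s (hs.trans htT)]
  simp [Set.Ioc_eq_empty (not_lt.2 hs)]

/-- Pass to the limit in `increment` along times increasing to `r`; the drift over the shrinking
interval vanishes. -/
theorem eq_leftLim_add_jump (h : IsInventoryPath Q V q₀ t T q ql ρ Jb Ja) {r : ℝ≥0}
    (hr : r ∈ Set.Ioc t T) :
    q r = ql r + (∫ x in {r} ×ˢ Set.univ, x.2 ∂Jb) - ∫ x in {r} ×ˢ Set.univ, x.2 ∂Ja := by
  obtain ⟨u, hmono, hu, hlim⟩ := exists_seq_strictMono_tendsto' hr.1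
  have hlim' : Tendsto u atTop (𝓝[<] r) :=
    tendsto_nhdsWithin_iff.2 ⟨hlim, Eventually.of_forall fun n => (hu n).2⟩
  have hrate : Tendsto (fun n => ∫ x in Set.Ioc (u n) r, ρ x ∂timeMeasure) atTop (𝓝 0) := by
    refine squeeze_zero_norm (a := fun n => V * ((r : ℝ) - u n))
      (fun n => h.abs_integral_rate_le (hu n).1.le (hu n).2.le hr.2) ?_
    have : Tendsto (fun n => (u n : ℝ)) atTop (𝓝 (r : ℝ)) := NNReal.tendsto_coe.2 hlim
    simpa using ((tendsto_const_nhds (x := (r : ℝ))).sub this).const_mul V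
  have h1 := ((((h.leftLim r).comp hlim').add
    (tendsto_setIntegral_Ioc_prod hr hmono hu hlim h.integrable_b)).sub
    (tendsto_setIntegral_Ioc_prod hr hmono hu hlim h.integrable_a)).add hrate
  have h2 : Tendsto (fun _ : ℕ => q r) atTop (𝓝 (q r)) := tendsto_const_nhds
  have h3 := tendsto_nhds_unique (h2.congr fun n => h.increment (hu n).1.le (hu n).2.le hr.2) h1
  rwa [add_zero] at h3

theorem mem_of_jump (h : IsInventoryPath Q V q₀ t T q ql ρ Jb Ja) {r : ℝ≥0}
    (hr : r ∈ Set.Ioc t T) (hne : (Jb + Ja) ({r} ×ˢ Set.univ) ≠ 0) : q r ∈ Set.Icc (-Q) Q := by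
  rw [h.eq_leftLim_add_jump hr]
  rw [Measure.add_apply] at hne
  rcases h.no_common r hr with h0 | h0
  · rw [h0, zero_add] at hne
    have := add_integral_jump_mem (σ := -1) (ql := ql) (Q := Q) h.integer_a (h.simple_a r) hr hne
      h.integrable_a (by filter_upwards [h.jump_a] with x hx; simpa [sub_eq_add_neg] using hx)
    rw [setIntegral_measure_zero _ h0]
    simpa [sub_eq_add_neg] using this
  · rw [h0, add_zero] at hne
    have := add_integral_jump_mem (σ := 1) (ql := ql) (Q := Q) h.integer_b (h.simple_b r) hr hne
      h.integrable_b (by filter_upwards [h.jump_b] with x hx; simpa using hx)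
    rw [setIntegral_measure_zero _ h0]
    simpa using this

theorem increment_of_no_jump (h : IsInventoryPath Q V q₀ t T q ql ρ Jb Ja) {r s : ℝ≥0}
    (htr : t ≤ r) (hrs : r ≤ s) (hs : s ≤ T) (h0 : (Jb + Ja) (Set.Ioc r s ×ˢ Set.univ) = 0) :
    |q s - q r| ≤ V * ((s : ℝ) - r) := by
  rw [Measure.add_apply, add_eq_zero] at h0
  rw [h.increment htr hrs hs, setIntegral_measure_zero _ h0.1, setIntegral_measure_zero _ h0.2]
  simpa using h.abs_integral_rate_le htr hrs hs

/-- At the last jump before `s`, or at the start, the path is in `[-Q, Q]`; from then on it moves at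
speed at most `V`. No use is made of the damping of the rate near the risk limits. -/
theorem abs_path_le (h : IsInventoryPath Q V q₀ t T q ql ρ Jb Ja) (htT : t ≤ T) {s : ℝ≥0}
    (hs : s ≤ T) : |q s| ≤ Q + V * T := by
  have hV := h.bound_nonneg
  rcases le_total s t with hst | hts
  · rw [h.before_start htT hst]
    have := abs_le.2 h.start_mem
    have : 0 ≤ V * T := mul_nonneg hV T.2
    linarith
  have hint : ∀ B, MeasurableSet B → ∃ n : ℕ∞, (Jb + Ja) B = n := by
    intro B hB
    obtain ⟨m, hm⟩ := h.integer_b B hB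
    obtain ⟨n, hn⟩ := h.integer_a B hB
    exact ⟨m + n, by simp [hm, hn]⟩
  have hfin : (Jb + Ja) (Set.Ioc t s ×ˢ Set.univ) < ∞ := by
    refine (measure_mono (Set.prod_mono_left (Set.Ioc_subset_Ioc_right hs))).trans_lt ?_
    rw [Measure.add_apply]
    exact ENNReal.add_lt_top.2 ⟨h.finite_b, h.finite_a⟩
  obtain ⟨r, hr, h0, hjump⟩ := exists_last_jump hint hfin hts
  have h1 := h.increment_of_no_jump hr.1 hr.2 hs h0
  have h2 : q r ∈ Set.Icc (-Q) Q := by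
    rcases eq_or_ne r t with rfl | hrt
    · rw [h.before_start htT le_rfl]
      exact h.start_mem
    · exact h.mem_of_jump ⟨lt_of_le_of_ne hr.1 hrt.symm, hr.2.trans hs⟩ (hjump.resolve_left hrt)
  have h3 : V * ((s : ℝ) - r) ≤ V * T := by
    refine mul_le_mul_of_nonneg_left ?_ hV
    have : (s : ℝ) ≤ T := by exact_mod_cast hs
    have := r.2
    linarith
  have h4 := abs_le.2 h2
  have h5 := abs_sub_abs_le_abs_sub (q s) (q r)
  linarith

/-- Time `0` needs its own hypothesis because it has no left neighbourhood. -/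
theorem leftLim_mem_of_forall (h : IsInventoryPath Q V q₀ t T q ql ρ Jb Ja) {S : Set ℝ}
    (hS : IsClosed S) (hq : ∀ s ≤ T, q s ∈ S) (hql : ql 0 ∈ S) {s : ℝ≥0} (hs : s ≤ T) :
    ql s ∈ S := by
  rcases eq_or_ne s 0 with rfl | h0
  · exact hql
  have : (𝓝[<] s).NeBot := nhdsLT_neBot_of_exists_lt ⟨0, pos_iff_ne_zero.2 h0⟩
  refine hS.mem_of_tendsto (h.leftLim s) ?_
  filter_upwards [self_mem_nhdsWithin] with r hr
  exact hq r ((le_of_lt hr).trans hs)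

theorem abs_leftLim_le (h : IsInventoryPath Q V q₀ t T q ql ρ Jb Ja) (htT : t ≤ T)
    (h0 : ql 0 = q 0) {s : ℝ≥0} (hs : s ≤ T) : |ql s| ≤ Q + V * T := by
  refine h.leftLim_mem_of_forall (S := {x | |x| ≤ Q + V * T})
    (isClosed_le continuous_abs continuous_const) (fun s hs => h.abs_path_le htT hs) ?_ hs
  rw [h0]
  exact h.abs_path_le htT zero_le

theorem abs_leftLim_sub_le (h : IsInventoryPath Q V q₀ t T q ql ρ Jb Ja) (htT : t ≤ T)
    (h0 : ql 0 = q 0) (hJ : (Jb + Ja) (Set.Ioc t T ×ˢ Set.univ) = 0) :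
    |ql T - q₀| ≤ V * ((T : ℝ) - t) := by
  have htT' : (t : ℝ) ≤ T := by exact_mod_cast htT
  have hall : ∀ s ≤ T, |q s - q₀| ≤ V * ((T : ℝ) - t) := by
    intro s hs
    rcases le_total s t with hst | hts
    · rw [h.before_start htT hst, sub_self, abs_zero]
      exact mul_nonneg h.bound_nonneg (sub_nonneg.2 htT')
    · have h1 := h.increment_of_no_jump le_rfl hts hs
        (measure_mono_null (Set.prod_mono_left (Set.Ioc_subset_Ioc_right hs)) hJ)
      rw [h.before_start htT le_rfl] at h1
      have hs' : (s : ℝ) ≤ T := by exact_mod_cast hs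
      exact h1.trans (mul_le_mul_of_nonneg_left (by linarith) h.bound_nonneg)
  refine h.leftLim_mem_of_forall (S := {x | |x - q₀| ≤ V * ((T : ℝ) - t)})
    (isClosed_le (by fun_prop) continuous_const) hall ?_ le_rfl
  rw [h0]
  exact hall 0 zero_le

end IsInventoryPath

end Paths

/-! ### Growth of the intensity functions -/

namespace IntensityHypotheses

variable {Λ : ℝ → ℝ}

theorem pos (h : IntensityHypotheses Λ) (δ : ℝ) : 0 < Λ δ :=
  (h.strictAnti.antitone.le_of_tendsto h.tendsto_zero (δ + 1)).trans_lt
    (h.strictAnti (lt_add_one δ))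

theorem hasDerivAt (h : IntensityHypotheses Λ) (δ : ℝ) : HasDerivAt Λ (deriv Λ δ) δ :=
  ((h.contDiff.differentiable (by norm_num)) δ).hasDerivAt

theorem hasDerivAt_deriv (h : IntensityHypotheses Λ) (δ : ℝ) :
    HasDerivAt (deriv Λ) (deriv (deriv Λ) δ) δ := by
  have h1 : ContDiff ℝ 1 (deriv Λ) := h.contDiff.deriv' 
  exact ((h1.differentiable (by norm_num)) δ).hasDerivAt

/-- The derivative of `-Λ / Λ' - x` is `Λ Λ'' / Λ'² - 2`, which is negative by hypothesis; hence `-Λ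
/ Λ'` grows with slope at most one. -/
theorem le_neg_deriv_mul (h : IntensityHypotheses Λ) {δ : ℝ} (hδ : 0 ≤ δ) :
    Λ δ ≤ -deriv Λ δ * (-(Λ 0 / deriv Λ 0) + δ) := by
  obtain ⟨c, hc, hle⟩ := h.sup_lt_two
  have hd : ∀ x, HasDerivAt (fun x => -(Λ x / deriv Λ x) - x)
      (-((deriv Λ x * deriv Λ x - Λ x * deriv (deriv Λ) x) / deriv Λ x ^ 2) - 1) x := fun x =>
    ((h.hasDerivAt x).div (h.hasDerivAt_deriv x) (h.deriv_neg x).ne).neg.sub (hasDerivAt_id x)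
  have hanti : Antitone fun x => -(Λ x / deriv Λ x) - x := by
    refine antitone_of_hasDerivAt_nonpos hd fun x => ?_
    have hne := (h.deriv_neg x).ne
    have := hle x
    rw [sub_div, ← sq, div_self (pow_ne_zero 2 hne), Pi.zero_apply]
    linarith
  have h1 := hanti hδ
  simp only [sub_zero] at h1
  have hneg : 0 < -deriv Λ δ := neg_pos.2 (h.deriv_neg δ)
  have h2 : Λ δ / -deriv Λ δ ≤ -(Λ 0 / deriv Λ 0) + δ := by
    rw [div_neg]
    linarith
  rwa [div_le_iff₀' hneg] at h2

/-- By `le_neg_deriv_mul`, `Λ x * (A + x)` is nonincreasing on `[0, ∞)`, which bounds `x * Λ x`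
there by `Λ 0 * A`. For negative quotes above `-d`, monotonicity of `Λ` suffices. -/
theorem exists_abs_mul_le (h : IntensityHypotheses Λ) (d : ℝ) :
    ∃ C, ∀ δ, -d ≤ δ → |δ * Λ δ| ≤ C := by
  set A := -(Λ 0 / deriv Λ 0) with hA
  have hA0 : 0 < A := by
    rw [hA, ← div_neg]
    exact div_pos (h.pos 0) (neg_pos.2 (h.deriv_neg 0))
  have hanti : AntitoneOn (fun x => Λ x * (A + x)) (Set.Ici 0) := by
    have hd : ∀ x, HasDerivAt (fun x => Λ x * (A + x)) (deriv Λ x * (A + x) + Λ x * 1) x :=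
      fun x => (h.hasDerivAt x).mul ((hasDerivAt_id x).const_add A)
    refine antitoneOn_of_deriv_nonpos (convex_Ici 0)
      (fun x _ => (hd x).continuousAt.continuousWithinAt)
      (fun x _ => (hd x).differentiableAt.differentiableWithinAt) fun x hx => ?_
    rw [interior_Ici] at hx
    rw [(hd x).deriv]
    have := h.le_neg_deriv_mul (le_of_lt hx)
    linarith
  have h0 := h.pos 0
  refine ⟨Λ 0 * A + |d| * Λ (-d), fun δ hδ => ?_⟩
  rw [abs_mul, abs_of_pos (h.pos δ)]
  have hd0 : 0 ≤ |d| * Λ (-d) := mul_nonneg (abs_nonneg _) (h.pos _).le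
  rcases le_total 0 δ with h1 | h1
  · have := hanti Set.self_mem_Ici h1 h1
    simp only [add_zero] at this
    rw [abs_of_nonneg h1]
    have := mul_pos (h.pos δ) hA0
    linarith
  · have h2 : |δ| ≤ |d| := by
      rw [abs_of_nonpos h1]
      exact (by linarith : -δ ≤ d).trans (le_abs_self d)
    have h3 := mul_le_mul h2 (h.strictAnti.antitone hδ) (h.pos δ).le (abs_nonneg d)
    have := mul_pos h0 hA0
    linarith

end IntensityHypotheses

/-- Admissibility bounds quotes only Lebesgue-almost everywhere in the size; absolute continuity
transfers this to the size law. -/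
theorem SizeLawHypotheses.ae_of_ae_volume {μ : Measure ℝ} (h : SizeLawHypotheses μ) {p : ℝ → Prop}
    (hp : ∀ᵐ z ∂(volume : Measure ℝ).restrict (Set.Ioi 0), p z) : ∀ᵐ z ∂μ, p z := by
  rw [ae_restrict_iff' measurableSet_Ioi] at hp
  have h1 := h.absolutelyContinuous.ae_le hp
  have h2 : ∀ᵐ z ∂μ, z ∉ Set.Iic (0 : ℝ) := measure_eq_zero_iff_ae_notMem.1 h.support
  filter_upwards [h1, h2] with z hz hz'
  exact hz (Set.mem_Ioi.2 (not_le.1 hz'))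

/-! ### Bounds and measurability of the rate and the execution cost -/

namespace Market

variable (M : Market)

theorem abs_rate_le (v y : ℝ) : |M.rate v y| ≤ |v| := by
  have h1 := M.ζ_mem (M.qMax + y)
  have h2 := M.ζ_mem (M.qMax - y)
  have h3 : v⁻ * M.ζ (M.qMax + y) ≤ v⁻ := mul_le_of_le_one_right (negPart_nonneg v) h1.2
  have h4 : v⁺ * M.ζ (M.qMax - y) ≤ v⁺ := mul_le_of_le_one_right (posPart_nonneg v) h2.2
  have h5 := mul_nonneg (negPart_nonneg v) h1.1
  have h6 := mul_nonneg (posPart_nonneg v) h2.1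
  have h7 := posPart_add_negPart v
  have h8 := posPart_nonneg v
  have h9 := negPart_nonneg v
  rw [rate, _root_.abs_le]
  constructor <;> linarith

theorem measurable_ζ : Measurable M.ζ := by
  obtain ⟨K, hK⟩ := M.ζ_lipschitz
  exact hK.continuous.measurable

theorem measurable_L_posPart : Measurable fun v : ℝ => M.L v⁺ :=
  Monotone.measurable fun _ _ hvw =>
    M.hL.mono (Set.mem_Ici.2 (posPart_nonneg _)) (Set.mem_Ici.2 (posPart_nonneg _))
      (posPart_mono hvw)

theorem measurable_L_negPart : Measurable fun v : ℝ => M.L (-v⁻) :=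
  Antitone.measurable fun _ _ hvw => M.hL.anti (Set.mem_Iic.2 (neg_nonpos.2 (negPart_nonneg _)))
    (Set.mem_Iic.2 (neg_nonpos.2 (negPart_nonneg _))) (neg_le_neg (negPart_anti hvw))

theorem measurable_rate : Measurable fun p : ℝ × ℝ => M.rate p.1 p.2 := by
  have hζ := M.measurable_ζ
  have h1 : Measurable fun v : ℝ => v⁺ := by
    simp only [posPart_def]; fun_prop
  have h2 : Measurable fun v : ℝ => v⁻ := by
    simp only [negPart_def]; fun_prop
  unfold rate
  fun_prop

theorem measurable_execCost : Measurable fun p : ℝ × ℝ => M.execCost p.1 p.2 := by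
  have hζ := M.measurable_ζ
  have h1 := M.measurable_L_posPart
  have h2 := M.measurable_L_negPart
  unfold execCost
  exact ((h2.comp measurable_fst).mul (hζ.comp (by fun_prop))).add
    ((h1.comp measurable_fst).mul (hζ.comp (by fun_prop)))

theorem abs_execCost_le {v : ℝ} (hv : |v| ≤ M.vMax) (y : ℝ) :
    |M.execCost v y| ≤ M.L (-M.vMax) + M.L M.vMax := by
  have hmax := M.vMax_pos.le
  have h1 := M.ζ_mem (M.qMax + y)
  have h2 := M.ζ_mem (M.qMax - y)
  have h3 : M.L (-v⁻) ≤ M.L (-M.vMax) := by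
    refine M.hL.anti (neg_nonpos.2 hmax) (neg_nonpos.2 (negPart_nonneg v)) (neg_le_neg ?_)
    have := posPart_add_negPart v
    linarith [posPart_nonneg v]
  have h4 : M.L v⁺ ≤ M.L M.vMax := by
    refine M.hL.mono (posPart_nonneg v) hmax ?_
    have := posPart_add_negPart v
    linarith [negPart_nonneg v]
  have n1 := M.hL.nonneg (-v⁻)
  have n2 := M.hL.nonneg v⁺
  rw [execCost, abs_of_nonneg (add_nonneg (mul_nonneg n1 h1.1) (mul_nonneg n2 h2.1))]
  exact add_le_add ((mul_le_of_le_one_right n1 h1.2).trans h3)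
    ((mul_le_of_le_one_right n2 h2.2).trans h4)

theorem measurableSet_bidSizes_graph : MeasurableSet {p : ℝ × ℝ | p.2 ∈ M.bidSizes p.1} :=
  (measurableSet_lt measurable_const measurable_snd).inter
    ((measurable_fst.add measurable_snd) measurableSet_Icc)

theorem measurableSet_askSizes_graph : MeasurableSet {p : ℝ × ℝ | p.2 ∈ M.askSizes p.1} :=
  (measurableSet_lt measurable_const measurable_snd).inter
    ((measurable_fst.sub measurable_snd) measurableSet_Icc)

end Market

/-! ### The running reward -/

section Reward

theorem abs_setIntegral_reward_le {μ : Measure ℝ} (hμ : SizeLawHypotheses μ) {Λ δ : ℝ → ℝ}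
    {d C : ℝ} (hC : ∀ x, -d ≤ x → |x * Λ x| ≤ C) (hδ : ∀ᵐ z ∂μ, -d ≤ δ z) (S : Set ℝ) :
    |∫ z in S, z * δ z * Λ (δ z) ∂μ| ≤ C * ∫ z, |z| ∂μ := by
  have hi : Integrable (fun z => C * |z|) μ := hμ.integrable_id.abs.const_mul C
  have hC0 : 0 ≤ C := (abs_nonneg _).trans (hC _ le_rfl)
  have h1 : ‖∫ z in S, z * δ z * Λ (δ z) ∂μ‖ ≤ ∫ z in S, C * |z| ∂μ := by
    refine norm_integral_le_of_norm_le hi.integrableOn (ae_restrict_of_ae ?_)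
    filter_upwards [hδ] with z hz
    rw [mul_assoc, norm_mul, mul_comm C]
    exact mul_le_mul_of_nonneg_left (hC _ hz) (abs_nonneg z)
  refine h1.trans ((setIntegral_le_integral hi (ae_of_all _ fun z => ?_)).trans_eq
    (integral_const_mul _ _))
  exact mul_nonneg hC0 (abs_nonneg z)

theorem exists_abs_runningReward_le (M : Market) (B : ℝ) :
    ∃ C, ∀ (δb δa : ℝ → ℝ) (v y : ℝ), (∀ᵐ z ∂M.μb, -M.δMax ≤ δb z) →
      (∀ᵐ z ∂M.μa, -M.δMax ≤ δa z) → |v| ≤ M.vMax → |y| ≤ B →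
      |runningReward M δb δa v y| ≤ C := by
  obtain ⟨Cb, hCb⟩ := M.hΛb.exists_abs_mul_le M.δMax
  obtain ⟨Ca, hCa⟩ := M.hΛa.exists_abs_mul_le M.δMax
  obtain ⟨D, hD⟩ := isCompact_Icc.exists_bound_of_continuousOn (s := Set.Icc (-B) B)
    M.ψ_continuous.continuousOn
  refine ⟨Cb * (∫ z, |z| ∂M.μb) + Ca * (∫ z, |z| ∂M.μa) + M.k * B * M.vMax
    + (M.L (-M.vMax) + M.L M.vMax) + D, fun δb δa v y hb ha hv hy => ?_⟩
  have h1 := abs_setIntegral_reward_le M.hμb hCb hb (M.bidSizes y)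
  have h2 := abs_setIntegral_reward_le M.hμa hCa ha (M.askSizes y)
  have h3 : |M.k * y * M.rate v y| ≤ M.k * B * M.vMax := by
    rw [abs_mul, abs_mul, abs_of_pos M.k_pos]
    have hB : 0 ≤ B := (abs_nonneg y).trans hy
    exact mul_le_mul (mul_le_mul_of_nonneg_left hy M.k_pos.le) ((M.abs_rate_le v y).trans hv)
      (abs_nonneg _) (mul_nonneg M.k_pos.le hB)
  have h4 := M.abs_execCost_le hv y
  have h5 : |M.ψ y| ≤ D := hD y (_root_.abs_le.1 hy)
  rw [_root_.abs_le] at h1 h2 h3 h4 h5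
  rw [runningReward, _root_.abs_le]
  constructor <;> linarith

theorem measurable_setIntegral_reward {X : Type*} [MeasurableSpace X] {μ : Measure ℝ} [SFinite μ]
    {Λ : ℝ → ℝ} (hΛ : Measurable Λ) {δ : X → ℝ → ℝ} (hδ : Measurable fun p : X × ℝ => δ p.1 p.2)
    {y : X → ℝ} (hy : Measurable y) {S : ℝ → Set ℝ}
    (hS : MeasurableSet {p : ℝ × ℝ | p.2 ∈ S p.1}) :
    Measurable fun x => ∫ z in S (y x), z * δ x z * Λ (δ x z) ∂μ := by
  have hSx : ∀ x, MeasurableSet (S (y x)) := fun x => measurable_prodMk_left (x := y x) hS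
  have hset : MeasurableSet {p : X × ℝ | p.2 ∈ S (y p.1)} :=
    ((hy.comp measurable_fst).prodMk measurable_snd) hS
  -- The domain of integration varies with `x`; an indicator on the product moves it into the
  -- integrand.
  have hf : Measurable fun p : X × ℝ => {p : X × ℝ | p.2 ∈ S (y p.1)}.indicator
      (fun p => p.2 * δ p.1 p.2 * Λ (δ p.1 p.2)) p :=
    ((measurable_snd.mul hδ).mul (hΛ.comp hδ)).indicator hset
  have h := (hf.stronglyMeasurable.integral_prod_right' (ν := μ)).measurable
  convert h using 2 with x
  rw [← integral_indicator (hSx x)]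
  rfl

theorem measurable_runningReward (M : Market) {X : Type*} [MeasurableSpace X] {δb δa : X → ℝ → ℝ}
    {v y : X → ℝ} (hb : Measurable fun p : X × ℝ => δb p.1 p.2)
    (ha : Measurable fun p : X × ℝ => δa p.1 p.2) (hv : Measurable v) (hy : Measurable y) :
    Measurable fun x => runningReward M (δb x) (δa x) (v x) (y x) := by
  have := M.hμb.isProbabilityMeasure
  have := M.hμa.isProbabilityMeasure
  have h1 := measurable_setIntegral_reward (μ := M.μb)
    M.hΛb.contDiff.continuous.measurable hb hy M.measurableSet_bidSizes_graph
  have h2 := measurable_setIntegral_reward (μ := M.μa)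
    M.hΛa.contDiff.continuous.measurable ha hy M.measurableSet_askSizes_graph
  have h3 := M.measurable_rate.comp (hv.prodMk hy)
  have h4 := M.measurable_execCost.comp (hv.prodMk hy)
  exact (((h1.add h2).add ((hy.const_mul M.k).mul h3)).sub h4).sub
    (M.ψ_continuous.measurable.comp hy)

end Reward

/-! ### Domination and support of the intensity kernels -/

section Intensity

theorem withDensity_restrict_le {μ : Measure ℝ} {Λ δ : ℝ → ℝ} (hΛ : Antitone Λ) {d : ℝ}
    (hδ : ∀ᵐ z ∂μ, -d ≤ δ z) (S : Set ℝ) :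
    (μ.restrict S).withDensity (fun z => ENNReal.ofReal (Λ (δ z))) ≤
      ENNReal.ofReal (Λ (-d)) • μ := by
  calc (μ.restrict S).withDensity (fun z => ENNReal.ofReal (Λ (δ z)))
      ≤ (μ.restrict S).withDensity (fun _ => ENNReal.ofReal (Λ (-d))) := by
        refine withDensity_mono (ae_restrict_of_ae ?_)
        filter_upwards [hδ] with z hz
        exact ENNReal.ofReal_le_ofReal (hΛ hz)
    _ = ENNReal.ofReal (Λ (-d)) • μ.restrict S := withDensity_const _
    _ ≤ ENNReal.ofReal (Λ (-d)) • μ := by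
        gcongr
        exact Measure.restrict_le_self

theorem withDensity_restrict_compl {μ : Measure ℝ} (f : ℝ → ℝ≥0∞) {S : Set ℝ}
    (hS : MeasurableSet S) : (μ.restrict S).withDensity f Sᶜ = 0 :=
  withDensity_absolutelyContinuous _ _ (by simp [Measure.restrict_apply hS.compl])

end Intensity

/-! ### Admissible controls along almost every path -/

section Controls

variable {Ω : Type*} [mΩ : MeasurableSpace Ω] {P : Measure Ω}
  {𝓕 : Filtration ℝ≥0 mΩ} {M : Market} {T : ℝ≥0}

theorem ae_ae_of_ae_prod_swap {X Y : Type*} [MeasurableSpace X] [MeasurableSpace Y]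
    {μ : Measure X} {ν : Measure Y} [SFinite μ] [SFinite ν] {p : X × Y → Prop}
    (h : ∀ᵐ x ∂μ.prod ν, p x) : ∀ᵐ y ∂ν, ∀ᵐ x ∂μ, p (x, y) :=
  Measure.ae_ae_of_ae_prod (Measure.measurePreserving_swap.quasiMeasurePreserving.ae h)

theorem Control.ae_v_le [SFinite P] (c : Control P 𝓕 M T) :
    ∀ᵐ ω ∂P, ∀ᵐ s ∂timeMeasure.restrict (Set.Icc 0 T), |c.v s ω| ≤ M.vMax :=
  ae_ae_of_ae_prod_swap c.v_le

theorem Control.ae_δ_ge [SFinite P] (c : Control P 𝓕 M T) :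
    ∀ᵐ ω ∂P, ∀ᵐ s ∂timeMeasure.restrict (Set.Icc 0 T),
      (∀ᵐ z ∂M.μb, -M.δMax ≤ c.δb s ω z) ∧ ∀ᵐ z ∂M.μa, -M.δMax ≤ c.δa s ω z := by
  filter_upwards [ae_ae_of_ae_prod_swap (Measure.ae_ae_of_ae_prod c.δ_ge)] with ω hω
  filter_upwards [hω] with s hs
  exact ⟨M.hμb.ae_of_ae_volume (hs.mono fun z hz => hz.trans (min_le_left _ _)),
    M.hμa.ae_of_ae_volume (hs.mono fun z hz => hz.trans (min_le_right _ _))⟩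

theorem Control.measurable_δb_prod (c : Control P 𝓕 M T) :
    Measurable fun x : (ℝ≥0 × Ω) × ℝ => c.δb x.1.1 x.1.2 x.2 :=
  c.measurable_δb.mono (markedPredictable_le_prod 𝓕) le_rfl

theorem Control.measurable_δa_prod (c : Control P 𝓕 M T) :
    Measurable fun x : (ℝ≥0 × Ω) × ℝ => c.δa x.1.1 x.1.2 x.2 :=
  c.measurable_δa.mono (markedPredictable_le_prod 𝓕) le_rfl

theorem Control.measurable_v_prod (c : Control P 𝓕 M T) :
    Measurable fun x : ℝ≥0 × Ω => c.v x.1 x.2 :=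
  c.measurable_v.mono (predictable_le_prod 𝓕) le_rfl

end Controls

/-! ### Consequences of the intensity formula -/

section HasIntensity

variable {Ω : Type*} [mΩ : MeasurableSpace Ω] {P : Measure Ω} {𝓕 : Filtration ℝ≥0 mΩ}
  {t T : ℝ≥0} {J : Ω → Measure (ℝ≥0 × ℝ)} {ν : ℝ≥0 → Ω → Measure ℝ} {μ : Measure ℝ} {C : ℝ≥0∞}

theorem measurable_mark (𝓕 : Filtration ℝ≥0 mΩ) {f : ℝ → ℝ≥0∞} (hf : Measurable f) :
    Measurable[markedPredictable 𝓕] fun x : (ℝ≥0 × Ω) × ℝ => f x.2 :=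
  hf.comp (@measurable_snd _ _ 𝓕.predictable (borel ℝ))

/-- Used with `f = 1` to bound the expected number of jumps and with `f` the norm to make the marks
integrable on almost every path. -/
theorem HasIntensity.lintegral_le [IsProbabilityMeasure P] (hI : HasIntensity P 𝓕 t T J ν)
    (hν : ∀ᵐ ω ∂P, ∀ᵐ s ∂timeMeasure.restrict (Set.Icc 0 T), ν s ω ≤ C • μ)
    {f : ℝ → ℝ≥0∞} (hf : Measurable f) :
    ∫⁻ ω, ∫⁻ x in Set.Ioc t T ×ˢ Set.univ, f x.2 ∂(J ω) ∂P ≤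
      C * (∫⁻ z, f z ∂μ) * ENNReal.ofReal ((T : ℝ) - t) := by
  have h := hI (fun x => f x.2) (measurable_mark 𝓕 hf)
  simp only at h
  rw [h]
  calc ∫⁻ ω, ∫⁻ s in Set.Ioc t T, ∫⁻ z, f z ∂(ν s ω) ∂timeMeasure ∂P
      ≤ ∫⁻ _, C * (∫⁻ z, f z ∂μ) * ENNReal.ofReal ((T : ℝ) - t) ∂P := by
        refine lintegral_mono_ae ?_
        filter_upwards [hν] with ω hω
        calc ∫⁻ s in Set.Ioc t T, ∫⁻ z, f z ∂(ν s ω) ∂timeMeasure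
            ≤ ∫⁻ _ in Set.Ioc t T, C * (∫⁻ z, f z ∂μ) ∂timeMeasure := by
              refine lintegral_mono_ae ?_
              filter_upwards [ae_restrict_of_ae_restrict_of_subset (Ioc_subset_Icc_zero t T) hω]
                with s hs
              refine (lintegral_mono' hs le_rfl).trans_eq ?_
              rw [lintegral_smul_measure, smul_eq_mul]
          _ = C * (∫⁻ z, f z ∂μ) * ENNReal.ofReal ((T : ℝ) - t) := by
              rw [setLIntegral_const, timeMeasure_Ioc]
    _ = C * (∫⁻ z, f z ∂μ) * ENNReal.ofReal ((T : ℝ) - t) := by simp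

theorem HasIntensity.lintegral_measure_le [IsProbabilityMeasure P] [IsProbabilityMeasure μ]
    (hI : HasIntensity P 𝓕 t T J ν)
    (hν : ∀ᵐ ω ∂P, ∀ᵐ s ∂timeMeasure.restrict (Set.Icc 0 T), ν s ω ≤ C • μ) :
    ∫⁻ ω, J ω (Set.Ioc t T ×ˢ Set.univ) ∂P ≤ C * ENNReal.ofReal ((T : ℝ) - t) := by
  simpa using hI.lintegral_le hν (f := fun _ => 1) measurable_const

theorem HasIntensity.ae_integrableOn [IsProbabilityMeasure P] (hI : HasIntensity P 𝓕 t T J ν)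
    (hJ : IsMarkedPointProcess 𝓕 J) (hC : C ≠ ∞)
    (hν : ∀ᵐ ω ∂P, ∀ᵐ s ∂timeMeasure.restrict (Set.Icc 0 T), ν s ω ≤ C • μ)
    (hμ : Integrable (fun z => z) μ) :
    ∀ᵐ ω ∂P, IntegrableOn (fun x => x.2) (Set.Ioc t T ×ˢ Set.univ) (J ω) := by
  have hf : Measurable fun z : ℝ => ‖z‖ₑ := measurable_enorm
  have hlt : ∫⁻ ω, ∫⁻ x in Set.Ioc t T ×ˢ Set.univ, ‖x.2‖ₑ ∂(J ω) ∂P ≠ ∞ :=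
    ((hI.lintegral_le hν hf).trans_lt (ENNReal.mul_lt_top
      (ENNReal.mul_lt_top hC.lt_top hμ.hasFiniteIntegral) ENNReal.ofReal_lt_top)).ne
  filter_upwards [ae_lt_top (hJ.measurable_lintegral t T (measurable_mark 𝓕 hf)) hlt] with ω hω
  exact ⟨measurable_snd.aestronglyMeasurable, hω⟩

/-- Testing the intensity formula on the indicator of `Gᶜ` shows that the expected number of points
outside `G` is zero. -/
theorem HasIntensity.ae_ae_mem (hI : HasIntensity P 𝓕 t T J ν) (hJ : IsMarkedPointProcess 𝓕 J)
    {G : Set ((ℝ≥0 × Ω) × ℝ)} (hG : MeasurableSet[markedPredictable 𝓕] G)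
    (hν : ∀ s ω, ν s ω {z | ((s, ω), z) ∉ G} = 0) :
    ∀ᵐ ω ∂P, ∀ᵐ x ∂(J ω).restrict (Set.Ioc t T ×ˢ Set.univ), ((x.1, ω), x.2) ∈ G := by
  have hH : Measurable[markedPredictable 𝓕] (Gᶜ.indicator fun _ => (1 : ℝ≥0∞)) :=
    measurable_const.indicator hG.compl
  have hG' : MeasurableSet G := markedPredictable_le_prod 𝓕 _ hG
  have hz := hI _ hH
  have hR : ∀ s ω, ∫⁻ z, Gᶜ.indicator (fun _ => (1 : ℝ≥0∞)) ((s, ω), z) ∂(ν s ω) = 0 := by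
    intro s ω
    have hm : MeasurableSet {z | ((s, ω), z) ∉ G} := measurable_prodMk_left hG'.compl
    have : (fun z => Gᶜ.indicator (fun _ => (1 : ℝ≥0∞)) ((s, ω), z)) =
        {z | ((s, ω), z) ∉ G}.indicator fun _ => 1 := rfl
    rw [this, lintegral_indicator hm]
    simpa using hν s ω
  simp only [hR, lintegral_zero] at hz
  rw [lintegral_eq_zero_iff (hJ.measurable_lintegral t T hH)] at hz
  filter_upwards [hz] with ω hω
  have hm : Measurable fun x : ℝ≥0 × ℝ => ((x.1, ω), x.2) := by fun_prop
  have hm' : Measurable fun x : ℝ≥0 × ℝ => Gᶜ.indicator (fun _ => (1 : ℝ≥0∞)) ((x.1, ω), x.2) :=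
    (measurable_const.indicator hG'.compl).comp hm
  rw [Pi.zero_apply, lintegral_eq_zero_iff hm'] at hω
  filter_upwards [hω] with x hx
  by_contra hcon
  simp [hcon] at hx

end HasIntensity

/-! ### The estimate for a controlled inventory -/

section Inventory

variable {Ω : Type*} [mΩ : MeasurableSpace Ω] {P : Measure Ω}
  {𝓕 : Filtration ℝ≥0 mΩ} {M : Market} {T t : ℝ≥0} {q₀ : ℝ} {c : Control P 𝓕 M T}

theorem ControlledInventory.measurable_leftLimit_prod (I : ControlledInventory P 𝓕 M T t q₀ c) :
    Measurable fun x : ℝ≥0 × Ω => leftLimit I.q x.1 x.2 :=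
  (measurable_leftLimit I.adapted I.leftLimits).mono (predictable_le_prod 𝓕) le_rfl

theorem Control.ae_bidIntensity_le [IsProbabilityMeasure P] (c : Control P 𝓕 M T) (y : ℝ≥0 → Ω → ℝ) :
    ∀ᵐ ω ∂P, ∀ᵐ s ∂timeMeasure.restrict (Set.Icc 0 T),
      M.bidIntensity (y s ω) (c.δb s ω) ≤ ENNReal.ofReal (M.Λb (-M.δMax)) • M.μb := by
  filter_upwards [c.ae_δ_ge] with ω hω
  filter_upwards [hω] with s hs
  exact withDensity_restrict_le M.hΛb.strictAnti.antitone hs.1 _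

theorem Control.ae_askIntensity_le [IsProbabilityMeasure P] (c : Control P 𝓕 M T) (y : ℝ≥0 → Ω → ℝ) :
    ∀ᵐ ω ∂P, ∀ᵐ s ∂timeMeasure.restrict (Set.Icc 0 T),
      M.askIntensity (y s ω) (c.δa s ω) ≤ ENNReal.ofReal (M.Λa (-M.δMax)) • M.μa := by
  filter_upwards [c.ae_δ_ge] with ω hω
  filter_upwards [hω] with s hs
  exact withDensity_restrict_le M.hΛa.strictAnti.antitone hs.2 _

theorem ControlledInventory.ae_bid_mem (I : ControlledInventory P 𝓕 M T t q₀ c) :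
    ∀ᵐ ω ∂P, ∀ᵐ x ∂(I.Jb ω).restrict (Set.Ioc t T ×ˢ Set.univ),
      x.2 ∈ M.bidSizes (leftLimit I.q x.1 ω) := by
  refine I.intensity_b.ae_ae_mem I.pointProcess_b
    (G := {x | x.2 ∈ M.bidSizes (leftLimit I.q x.1.1 x.1.2)}) ?_ fun s ω =>
      withDensity_restrict_compl _ (measurable_prodMk_left M.measurableSet_bidSizes_graph)
  exact (Measurable.prodMk
    ((measurable_leftLimit I.adapted I.leftLimits).comp (@measurable_fst _ _ 𝓕.predictable _))
    (@measurable_snd _ _ 𝓕.predictable _)) M.measurableSet_bidSizes_graph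

theorem ControlledInventory.ae_ask_mem (I : ControlledInventory P 𝓕 M T t q₀ c) :
    ∀ᵐ ω ∂P, ∀ᵐ x ∂(I.Ja ω).restrict (Set.Ioc t T ×ˢ Set.univ),
      x.2 ∈ M.askSizes (leftLimit I.q x.1 ω) := by
  refine I.intensity_a.ae_ae_mem I.pointProcess_a
    (G := {x | x.2 ∈ M.askSizes (leftLimit I.q x.1.1 x.1.2)}) ?_ fun s ω =>
      withDensity_restrict_compl _ (measurable_prodMk_left M.measurableSet_askSizes_graph)
  exact (Measurable.prodMk
    ((measurable_leftLimit I.adapted I.leftLimits).comp (@measurable_fst _ _ 𝓕.predictable _))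
    (@measurable_snd _ _ 𝓕.predictable _)) M.measurableSet_askSizes_graph

/-- Collects the almost sure properties on one event, so that the deterministic path bounds apply
for almost every `ω`. -/
theorem ControlledInventory.ae_isInventoryPath [IsProbabilityMeasure P] (I : ControlledInventory P 𝓕 M T t q₀ c)
    (hq : q₀ ∈ M.Q) :
    ∀ᵐ ω ∂P, IsInventoryPath M.qMax M.vMax q₀ t T (fun s => I.q s ω)
      (fun s => leftLimit I.q s ω) (fun s => M.rate (c.v s ω) (leftLimit I.q s ω))
      (I.Jb ω) (I.Ja ω) := by
  filter_upwards [I.no_common_jumps, I.dynamics, I.ae_bid_mem, I.ae_ask_mem, c.ae_v_le,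
    I.intensity_b.ae_integrableOn I.pointProcess_b ENNReal.ofReal_ne_top (c.ae_bidIntensity_le _)
      M.hμb.integrable_id,
    I.intensity_a.ae_integrableOn I.pointProcess_a ENNReal.ofReal_ne_top (c.ae_askIntensity_le _)
      M.hμa.integrable_id] with ω hcommon hdyn hb ha hv hib hia
  have hrate : ∀ᵐ s ∂timeMeasure.restrict (Set.Ioc t T),
      |M.rate (c.v s ω) (leftLimit I.q s ω)| ≤ M.vMax := by
    filter_upwards [ae_restrict_of_ae_restrict_of_subset (Ioc_subset_Icc_zero t T) hv] with s hs
    exact (M.abs_rate_le _ _).trans hs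
  have hmeas : Measurable fun s => M.rate (c.v s ω) (leftLimit I.q s ω) :=
    M.measurable_rate.comp ((c.measurable_v_prod.comp measurable_prodMk_right).prodMk
      (I.measurable_leftLimit_prod.comp measurable_prodMk_right))
  have hfin : timeMeasure (Set.Ioc t T) < ∞ := by
    rw [timeMeasure_Ioc]
    exact ENNReal.ofReal_lt_top
  exact
    { start_mem := hq
      bound_nonneg := M.vMax_pos.le
      integer_b := I.pointProcess_b.integerValued ω
      integer_a := I.pointProcess_a.integerValued ω
      finite_b := I.pointProcess_b.measure_Ioc_lt_top ω t T
      finite_a := I.pointProcess_a.measure_Ioc_lt_top ω t T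
      simple_b := I.pointProcess_b.simple ω
      simple_a := I.pointProcess_a.simple ω
      integrable_b := hib
      integrable_a := hia
      no_common := hcommon
      dynamics := hdyn
      integrable_rate := IntegrableOn.of_bound hfin hmeas.aestronglyMeasurable M.vMax hrate
      rate_le := hrate
      leftLim := tendsto_leftLimit (I.leftLimits ω)
      jump_b := hb.mono fun _ hx => hx.2
      jump_a := ha.mono fun _ hx => hx.2 }

theorem ControlledInventory.lintegral_jumps_le [IsProbabilityMeasure P] (I : ControlledInventory P 𝓕 M T t q₀ c) :
    ∫⁻ ω, (I.Jb ω + I.Ja ω) (Set.Ioc t T ×ˢ Set.univ) ∂P ≤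
      ENNReal.ofReal ((M.Λb (-M.δMax) + M.Λa (-M.δMax)) * ((T : ℝ) - t)) := by
  have := M.hμb.isProbabilityMeasure
  have := M.hμa.isProbabilityMeasure
  have hb := (M.hΛb.pos (-M.δMax)).le
  have ha := (M.hΛa.pos (-M.δMax)).le
  simp only [Measure.add_apply]
  rw [lintegral_add_left (I.pointProcess_b.measurable_measure_Ioc_prod t T .univ),
    ENNReal.ofReal_mul (add_nonneg hb ha), ENNReal.ofReal_add hb ha, add_mul]
  exact add_le_add (I.intensity_b.lintegral_measure_le (c.ae_bidIntensity_le _))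
    (I.intensity_a.lintegral_measure_le (c.ae_askIntensity_le _))

theorem ControlledInventory.measurable_payoff (I : ControlledInventory P 𝓕 M T t q₀ c) :
    Measurable fun ω => (∫ s in Set.Ioc t T,
      runningReward M (c.δb s ω) (c.δa s ω) (c.v s ω) (leftLimit I.q s ω) ∂timeMeasure)
        - M.ell (leftLimit I.q T ω) := by
  have h1 := measurable_runningReward M (X := ℝ≥0 × Ω) (δb := fun x => c.δb x.1 x.2)
    (δa := fun x => c.δa x.1 x.2) (v := fun x => c.v x.1 x.2)
    (y := fun x => leftLimit I.q x.1 x.2) c.measurable_δb_prod c.measurable_δa_prod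
    c.measurable_v_prod I.measurable_leftLimit_prod
  have h2 := (h1.stronglyMeasurable.integral_prod_left'
    (μ := timeMeasure.restrict (Set.Ioc t T))).measurable
  exact h2.sub (M.ell_continuous.measurable.comp
    (I.measurable_leftLimit_prod.comp measurable_prodMk_left))

/-- The three terms are the running reward, the change of `ell` under pure drift, and the change of
`ell` when a jump occurs. -/
theorem ControlledInventory.abs_objective_add_le [IsProbabilityMeasure P] (I : ControlledInventory P 𝓕 M T t q₀ c)
    (hq : q₀ ∈ M.Q) (htT : t ≤ T) {C S η : ℝ}
    (hC : ∀ (δb δa : ℝ → ℝ) (v y : ℝ), (∀ᵐ z ∂M.μb, -M.δMax ≤ δb z) →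
      (∀ᵐ z ∂M.μa, -M.δMax ≤ δa z) → |v| ≤ M.vMax → |y| ≤ M.qMax + M.vMax * T →
      |runningReward M δb δa v y| ≤ C)
    (hS : ∀ y, |y| ≤ M.qMax + M.vMax * T → |M.ell y| ≤ S) (hη0 : 0 ≤ η)
    (hη : ∀ y, |y| ≤ M.qMax + M.vMax * T → |y - q₀| ≤ M.vMax * ((T : ℝ) - t) →
      |M.ell y - M.ell q₀| ≤ η) :
    |objective I + M.ell q₀| ≤ C * ((T : ℝ) - t) + η
      + 2 * S * ((M.Λb (-M.δMax) + M.Λa (-M.δMax)) * ((T : ℝ) - t)) := by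
  set A : Set (ℝ≥0 × ℝ) := Set.Ioc t T ×ˢ Set.univ with hA
  set F : Ω → ℝ := fun ω => (∫ s in Set.Ioc t T,
      runningReward M (c.δb s ω) (c.δa s ω) (c.v s ω) (leftLimit I.q s ω) ∂timeMeasure)
        - M.ell (leftLimit I.q T ω) with hF
  set N : Ω → ℝ := fun ω => ((I.Jb ω + I.Ja ω) A).toReal with hN
  have htT' : (t : ℝ) ≤ T := by exact_mod_cast htT
  have hq0 : |q₀| ≤ M.qMax + M.vMax * T := by
    have h1 : |q₀| ≤ M.qMax := _root_.abs_le.2 hq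
    have := mul_nonneg M.vMax_pos.le T.2
    exact h1.trans (le_add_of_nonneg_right this)
  have hS0 : 0 ≤ S := (abs_nonneg _).trans (hS _ hq0)
  have hrate0 : 0 ≤ (M.Λb (-M.δMax) + M.Λa (-M.δMax)) * ((T : ℝ) - t) :=
    mul_nonneg (add_nonneg (M.hΛb.pos _).le (M.hΛa.pos _).le) (sub_nonneg.2 htT')
  have hlt : ∀ ω, (I.Jb ω + I.Ja ω) A < ∞ := fun ω => by
    rw [Measure.add_apply]
    exact ENNReal.add_lt_top.2 ⟨I.pointProcess_b.measure_Ioc_lt_top ω t T,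
      I.pointProcess_a.measure_Ioc_lt_top ω t T⟩
  have hNm : Measurable fun ω => (I.Jb ω + I.Ja ω) A := by
    simp only [Measure.add_apply]
    exact (I.pointProcess_b.measurable_measure_Ioc_prod t T .univ).add
      (I.pointProcess_a.measurable_measure_Ioc_prod t T .univ)
  have hNi : Integrable N P := integrable_toReal_of_lintegral_ne_top hNm.aemeasurable
    (I.lintegral_jumps_le.trans_lt ENNReal.ofReal_lt_top).ne
  have hNle : ∫ ω, N ω ∂P ≤ (M.Λb (-M.δMax) + M.Λa (-M.δMax)) * ((T : ℝ) - t) := by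
    rw [hN, integral_toReal hNm.aemeasurable (ae_of_all _ hlt)]
    exact ENNReal.toReal_le_of_le_ofReal hrate0 I.lintegral_jumps_le
  have hbound : ∀ᵐ ω ∂P, ‖F ω + M.ell q₀‖ ≤ C * ((T : ℝ) - t) + η + 2 * S * N ω := by
    filter_upwards [I.ae_isInventoryPath hq, c.ae_δ_ge, c.ae_v_le] with ω hpath hδ hv
    have h0 : leftLimit I.q 0 ω = I.q 0 ω := leftLimit_zero _ _
    have hrun : |∫ s in Set.Ioc t T, runningReward M (c.δb s ω) (c.δa s ω) (c.v s ω)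
        (leftLimit I.q s ω) ∂timeMeasure| ≤ C * ((T : ℝ) - t) := by
      have hfin : timeMeasure (Set.Ioc t T) < ∞ := by
        rw [timeMeasure_Ioc]
        exact ENNReal.ofReal_lt_top
      rw [← timeMeasure_real_Ioc htT, ← Real.norm_eq_abs]
      refine norm_setIntegral_le_of_norm_le_const_ae' hfin ?_
      rw [← ae_restrict_iff' measurableSet_Ioc]
      filter_upwards [ae_restrict_of_ae_restrict_of_subset (Ioc_subset_Icc_zero t T) hδ,
        ae_restrict_of_ae_restrict_of_subset (Ioc_subset_Icc_zero t T) hv,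
        ae_restrict_mem measurableSet_Ioc] with s h1 h2 h3
      exact hC _ _ _ _ h1.1 h1.2 h2 (hpath.abs_leftLim_le htT h0 h3.2)
    have hterm : |M.ell (leftLimit I.q T ω) - M.ell q₀| ≤ η + 2 * S * N ω := by
      have hqT := hpath.abs_leftLim_le htT h0 le_rfl
      -- With no jump the drift bound gives `η`. Otherwise the jump count, being an integer, is at
      -- least one and absorbs the crude bound `2 * S`.
      by_cases hJ : (I.Jb ω + I.Ja ω) A = 0
      · have h1 := hη _ hqT (hpath.abs_leftLim_sub_le htT h0 hJ)
        have h2 : N ω = 0 := by simp only [hN, hJ, ENNReal.toReal_zero]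
        rw [h2]
        linarith
      · have h1 : 1 ≤ N ω := by
          obtain ⟨m, hm⟩ := I.pointProcess_b.integerValued ω A (measurableSet_Ioc.prod .univ)
          obtain ⟨n, hn⟩ := I.pointProcess_a.integerValued ω A (measurableSet_Ioc.prod .univ)
          have hmn : (I.Jb ω + I.Ja ω) A = ((m + n : ℕ∞) : ℝ≥0∞) := by
            rw [Measure.add_apply, hm, hn]
            simp
          have hle : 1 ≤ (I.Jb ω + I.Ja ω) A := by
            rw [hmn] at hJ ⊢
            exact_mod_cast Order.one_le_iff_ne_zero.2 (by exact_mod_cast hJ)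
          simpa [hN] using ENNReal.toReal_mono (hlt ω).ne hle
        have h2 := abs_sub (M.ell (leftLimit I.q T ω)) (M.ell q₀)
        have h3 := hS _ hqT
        have h4 := hS _ hq0
        have h5 := mul_le_mul_of_nonneg_left h1 (by linarith : 0 ≤ 2 * S)
        linarith
    have hsplit : F ω + M.ell q₀ = (∫ s in Set.Ioc t T, runningReward M (c.δb s ω) (c.δa s ω)
        (c.v s ω) (leftLimit I.q s ω) ∂timeMeasure)
          - (M.ell (leftLimit I.q T ω) - M.ell q₀) := by
      rw [hF]; ring
    rw [hsplit, Real.norm_eq_abs]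
    refine (abs_sub _ _).trans ?_
    linarith
  have hbi : Integrable (fun ω => C * ((T : ℝ) - t) + η + 2 * S * N ω) P :=
    (integrable_const _).add (hNi.const_mul _)
  have hFm : Measurable F := I.measurable_payoff
  -- Integrability must be established before splitting off the constant, since the Bochner integral
  -- is zero by default; it follows from the pointwise bound.
  have hFi : Integrable F P := by
    have h1 : Integrable (fun ω => F ω + M.ell q₀) P :=
      hbi.mono' (hFm.add_const _).aestronglyMeasurable hbound
    convert h1.sub (integrable_const (M.ell q₀)) using 1
    ext ω
    simp
  have hobj : objective I + M.ell q₀ = ∫ ω, (F ω + M.ell q₀) ∂P := by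
    rw [integral_add hFi (integrable_const _), integral_const, probReal_univ, one_smul]
    rfl
  rw [hobj, ← Real.norm_eq_abs]
  refine (norm_integral_le_of_norm_le hbi hbound).trans ?_
  rw [integral_add (integrable_const _) (hNi.const_mul _), integral_const, integral_const_mul,
    probReal_univ, one_smul]
  have := mul_le_mul_of_nonneg_left hNle (by linarith : 0 ≤ 2 * S)
  linarith

end Inventory

/-! ### Convergence of the value function -/

section ValueFunction

variable {Ω : Type*} [mΩ : MeasurableSpace Ω] {P : Measure Ω}
  {𝓕 : Filtration ℝ≥0 mΩ} {M : Market} {T : ℝ≥0}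

/-- The control with vanishing quotes and no execution. -/
noncomputable instance : Inhabited (Control P 𝓕 M T) where
  default :=
    { δb := fun _ _ _ => 0
      δa := fun _ _ _ => 0
      v := fun _ _ => 0
      measurable_δb := measurable_const
      measurable_δa := measurable_const
      measurable_v := measurable_const
      δ_ge := ae_of_all _ fun _ => by simpa using M.δMax_pos.le
      v_le := ae_of_all _ fun _ => by simpa using M.vMax_pos.le }

/-- The constants `C`, `S` and the modulus `d` depend only on the market and `T`, so one
neighbourhood of `T` serves all inventories and controls. Half of `e` pays for the drift in `ell`,
half for the terms linear in `T - t`. -/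
theorem eventually_abs_objective_add_le [IsProbabilityMeasure P] (I : InventoryFamily P 𝓕 M T)
    {e : ℝ} (he : 0 < e) :
    ∀ᶠ t : Set.Icc (0 : ℝ≥0) T in 𝓝 ⟨T, zero_le, le_rfl⟩, ∀ (y : M.Q) (c : Control P 𝓕 M T),
      |objective (I t y c) + M.ell y| ≤ e := by
  set B := M.qMax + M.vMax * T with hB
  obtain ⟨C, hC⟩ := exists_abs_runningReward_le M B
  obtain ⟨S, hS⟩ := isCompact_Icc.exists_bound_of_continuousOn (s := Set.Icc (-B) B)
    M.ell_continuous.continuousOn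
  obtain ⟨d, hd0, hd⟩ := Metric.uniformContinuousOn_iff.1
    ((isCompact_Icc (a := -B) (b := B)).uniformContinuousOn_of_continuous
      M.ell_continuous.continuousOn) (e / 2) (half_pos he)
  have hsub : Tendsto (fun t : Set.Icc (0 : ℝ≥0) T => (T : ℝ) - (t : ℝ≥0))
      (𝓝 ⟨T, zero_le, le_rfl⟩) (𝓝 0) := by
    have : Continuous fun t : Set.Icc (0 : ℝ≥0) T => (T : ℝ) - (t : ℝ≥0) := by fun_prop
    simpa using this.tendsto ⟨T, zero_le, le_rfl⟩
  have h1 : ∀ᶠ t : Set.Icc (0 : ℝ≥0) T in 𝓝 ⟨T, zero_le, le_rfl⟩,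
      M.vMax * ((T : ℝ) - (t : ℝ≥0)) < d := by
    refine (hsub.const_mul M.vMax).eventually_lt_const ?_
    simpa using hd0
  have h2 : ∀ᶠ t : Set.Icc (0 : ℝ≥0) T in 𝓝 ⟨T, zero_le, le_rfl⟩,
      C * ((T : ℝ) - (t : ℝ≥0)) + 2 * S * ((M.Λb (-M.δMax) + M.Λa (-M.δMax))
        * ((T : ℝ) - (t : ℝ≥0))) < e / 2 := by
    refine ((hsub.const_mul C).add ((hsub.const_mul _).const_mul (2 * S))).eventually_lt_const ?_
    simpa using he
  filter_upwards [h1, h2] with t ht1 ht2 y c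
  have hyB : (y : ℝ) ∈ Set.Icc (-B) B := by
    have := mul_nonneg M.vMax_pos.le T.2
    have hy : -M.qMax ≤ (y : ℝ) ∧ (y : ℝ) ≤ M.qMax := y.2
    have hT : 0 ≤ M.vMax * (T : ℝ) := this
    constructor <;> linarith [hy.1, hy.2]
  have h := (I t y c).abs_objective_add_le y.2 t.2.2 hC (fun x hx => hS x (_root_.abs_le.1 hx))
    (half_pos he).le (fun x hx hxy => (hd x (_root_.abs_le.1 hx) y hyB (hxy.trans_lt ht1)).le)
  linarith

theorem tendsto_valueFunction [IsProbabilityMeasure P] (I : InventoryFamily P 𝓕 M T) (q : M.Q) :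
    Tendsto (valueFunction I) (𝓝 ((⟨T, zero_le, le_rfl⟩ : Set.Icc (0 : ℝ≥0) T), q))
      (𝓝 ((-M.ell q : ℝ) : EReal)) := by
  have key : ∀ e : ℝ, 0 < e →
      ∀ᶠ x in 𝓝 ((⟨T, zero_le, le_rfl⟩ : Set.Icc (0 : ℝ≥0) T), q),
        ((-M.ell q - e : ℝ) : EReal) ≤ valueFunction I x ∧
          valueFunction I x ≤ ((-M.ell q + e : ℝ) : EReal) := by
    intro e he
    have h1 := (continuous_fst.tendsto
      ((⟨T, zero_le, le_rfl⟩ : Set.Icc (0 : ℝ≥0) T), q)).eventually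
        (eventually_abs_objective_add_le I (half_pos he))
    have hcont : Continuous fun x : Set.Icc (0 : ℝ≥0) T × M.Q => M.ell x.2 :=
      M.ell_continuous.comp (by fun_prop)
    have h2 := (Metric.tendsto_nhds.1
      (hcont.tendsto ((⟨T, zero_le, le_rfl⟩ : Set.Icc (0 : ℝ≥0) T), q))) (e / 2) (half_pos he)
    filter_upwards [h1, h2] with x hx1 hx2
    rw [Real.dist_eq] at hx2
    have hx2 := abs_lt.1 hx2
    constructor
    -- A single control suffices from below; one must exist, as an empty supremum would be `⊥`.
    · refine le_iSup_of_le default (EReal.coe_le_coe_iff.2 ?_)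
      have := _root_.abs_le.1 (hx1 x.2 default)
      linarith [this.1]
    · refine iSup_le fun c => EReal.coe_le_coe_iff.2 ?_
      have := _root_.abs_le.1 (hx1 x.2 c)
      linarith [this.2]
  refine tendsto_order.2 ⟨fun a ha => ?_, fun a ha => ?_⟩
  -- The level `a` may be infinite; a real number in between supplies a finite tolerance.
  · obtain ⟨r, har, hr⟩ := EReal.lt_iff_exists_real_btwn.1 ha
    have hr' : r < -M.ell q := EReal.coe_lt_coe_iff.1 hr
    filter_upwards [key (-M.ell q - r) (by linarith)] with x hx
    refine har.trans_le ?_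
    simpa using hx.1
  · obtain ⟨r, hr, har⟩ := EReal.lt_iff_exists_real_btwn.1 ha
    have hr' : -M.ell q < r := EReal.coe_lt_coe_iff.1 hr
    filter_upwards [key (r + M.ell q) (by linarith)] with x hx
    refine lt_of_le_of_lt ?_ har
    simpa using hx.2

end ValueFunction

end MarketMaking

theorem mainTheorem5 {Ω : Type*} [mΩ : MeasurableSpace Ω] (P : Measure Ω) [IsProbabilityMeasure P]
    (𝓕 : Filtration ℝ≥0 mΩ) (h𝓕 : MarketMaking.UsualConditions P 𝓕)
    (M : MarketMaking.Market) (T : ℝ≥0) (I : MarketMaking.InventoryFamily P 𝓕 M T) (q : M.Q) :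
    MarketMaking.lowerEnvelope (MarketMaking.valueFunction I)
        ((⟨T, zero_le, le_rfl⟩ : Set.Icc (0 : ℝ≥0) T), q) = ((-M.ell q : ℝ) : EReal) ∧
      MarketMaking.upperEnvelope (MarketMaking.valueFunction I)
        ((⟨T, zero_le, le_rfl⟩ : Set.Icc (0 : ℝ≥0) T), q) = ((-M.ell q : ℝ) : EReal) := by
  have h := MarketMaking.tendsto_valueFunction I q
  exact ⟨h.liminf_eq, h.limsup_eq⟩
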